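/- Let $f\colon\Gamma\to G$ be a homomorphism of groups. A central $f$-extension of $G$ with kernel the abelian group $A$ is a central extension $0\to A\to M\xrightarrow{n} G\to 1$ together with a homomorphism (structure map) $\psi\colon\Gamma\to M$ such that $n\psi=f$. A map $(M,\psi)\to(M',\psi')$ of central $f$-extensions, with kernels $A,A'$, is a pair of homomorphisms $\kappa\colon A\to A'$, $\tau\colon M\to M'$ compatible with the inclusions of the kernels, with the projections to $G$ and with the structure maps; two central $f$-extensions with the same kernel are equivalent if there is a map between them with $\kappa=\mathrm{id}$. Let $H_*(G,\Gamma)$ be the homology of the mapping cone of $C_*(f)\colon C_*(\Gamma;\mathbb Z)\to C_*(G;\mathbb Z)$ (inhomogeneous chains), i.e. of $C_n(G,\Gamma)=C_n(G)\oplus C_{n-1}(\Gamma)$ with $d(x,y)=(dx-f_*(y),-dy)$. Given a central $f$-extension $(M,\psi)$ with kernel $A\subseteq M$ and a set-theoretic section $\sigma\colon G\to M$, define $c\colon G\times G\to A$ and $w\colon\Gamma\to A$ by $\sigma(g)\sigma(h)=c(g,h)\sigma(gh)$ and $\psi(\gamma)=w(\gamma)\,\sigma(f(\gamma))$. Then $(c,w)$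 is a relative $2$-cocycle, and $[(x,y)]\mapsto c(x)+w(y)$ is a homomorphism $H_2(G,\Gamma)\to A$, independent of $\sigma$, which is said to correspond to $(M,\psi)$. If $f$ is surjective on abelianizations, the universal central $f$-extension is the central $f$-extension with kernel $H_2(G,\Gamma)$, unique up to equivalence, that corresponds to the identity of $H_2(G,\Gamma)$. For every surjective homomorphism $f\colon\Gamma\to G$ with kernel $K$ there is an isomorphism $$\theta_f\colon H_2(G,\Gamma)\xrightarrow{\ \cong\ }K/[K,\Gamma]$$ such that: 1. The central $f$-extension $K/[K,\Gamma]\to\Gamma/[K,\Gamma]\to G$, with the natural quotient map $\Gamma\to\Gamma/[K,\Gamma]$ as structure map and with its kernel identified with $H_2(G,\Gamma)$ through $\theta_f$, is the universal central $f$-extension: it corresponds to the identity of $H_2(G,\Gamma)$; a central $f$-extension with kernel $H_2(G,\Gamma)$ corresponds to the identity if and only if it is equivalent to this one; and there is exactly one map from this one to any central $f$-extension of $G$. 2. $\theta_f$ is natural: if $f'\colon\Gamma'\to G'$ is another surjection, with kernel $K'$, and $a\colon\Gamma\to\Gamma'$, $b\colon G\to G'$ are homomorphisms with $bf=f'a$,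 then $\theta_{f'}\circ(b,a)_*$ is the composition of $\theta_f$ with the map $K/[K,\Gamma]\to K'/[K',\Gamma']$ induced by $a$. 3. With the map $H_2(G)\to H_2(G,\Gamma)\xrightarrow{\theta_f}K/[K,\Gamma]$ and the obvious other maps, the five term sequence $$H_2(\Gamma)\to H_2(G)\to K/[K,\Gamma]\to\Gamma_{ab}\to G_{ab}\to 0$$ is exact. 4. (Hopf's formula) If $\Gamma=F$ is a free group and $R=K$, then $H_2(G)\to R/[R,F]$ is injective and is an isomorphism of $H_2(G)$ onto $(R\cap[F,F])/[R,F]$. -/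

import Mathlib

open CategoryTheory

universe u

namespace RelativeSchur

noncomputable section

/-! ### Integral chains and homology of groups

`ULift.{u} ℤ` is the ring of integers, placed in the universe of the groups; Mathlib's group
homology asks for coefficients in that universe. -/

/-- The trivial `G`-module `ℤ`. -/
abbrev trivialZ (G : Type u) [Group G] : Rep.{u} (ULift.{u} ℤ) G :=
  Rep.trivial (ULift.{u} ℤ) G (ULift.{u} ℤ)

/-- The chain complex `C_*(G; ℤ)` of inhomogeneous chains: `C_n(G; ℤ)` is free on `G^n`. -/
abbrev chains (G : Type u) [Group G] : ChainComplex (ModuleCat.{u} (ULift.{u} ℤ)) ℕ :=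
  groupHomology.inhomogeneousChains (trivialZ G)

/-- `H_n(G; ℤ)`. -/
abbrev H (n : ℕ) (G : Type u) [Group G] : ModuleCat.{u} (ULift.{u} ℤ) :=
  groupHomology (trivialZ G) n

variable {Γ G : Type u} [Group Γ] [Group G]

/-- The identity of `ℤ`, as a map of `Γ`-modules from `ℤ` to the restriction of `ℤ` along `f`. -/
abbrev trivialZRes (f : Γ →* G) : trivialZ Γ ⟶ Rep.res f (trivialZ G) :=
  𝟙 (trivialZ Γ)

/-- The chain map `C_*(f) : C_*(Γ; ℤ) ⟶ C_*(G; ℤ)`. -/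
abbrev chainsMap (f : Γ →* G) : chains Γ ⟶ chains G :=
  groupHomology.chainsMap f (trivialZRes f)

/-- The homomorphism `H_n(Γ; ℤ) ⟶ H_n(G; ℤ)` induced by `f`. -/
abbrev HMap (n : ℕ) (f : Γ →* G) : H n Γ ⟶ H n G :=
  groupHomology.map f (trivialZRes f) n

/-! ### Relative homology: the mapping cone -/

/-- `C_n(G, Γ) = C_n(G) ⊕ C_{n-1}(Γ)`, where `C_{-1}(Γ) = 0`. -/
def relX (_f : Γ →* G) : ℕ → ModuleCat.{u} (ULift.{u} ℤ)
  | 0 => (chains G).X 0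
  | n + 1 => ModuleCat.of _ ((chains G).X (n + 1) × (chains Γ).X n)

/-- The differential `d (x, y) = (d x - f y, - d y)` of the mapping cone. -/
def relD (f : Γ →* G) : (n : ℕ) → (relX f (n + 1) ⟶ relX f n)
  | 0 => ModuleCat.ofHom <|
      ((chains G).d 1 0).hom ∘ₗ LinearMap.fst _ _ _ -
        ((chainsMap f).f 0).hom ∘ₗ LinearMap.snd _ _ _
  | n + 1 => ModuleCat.ofHom <|
      (((chains G).d (n + 2) (n + 1)).hom ∘ₗ LinearMap.fst _ _ _ -
        ((chainsMap f).f (n + 1)).hom ∘ₗ LinearMap.snd _ _ _).prod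
      (-(((chains Γ).d (n + 1) n).hom ∘ₗ LinearMap.snd _ _ _))

theorem relD_comp_relD (f : Γ →* G) (n : ℕ) : relD f (n + 1) ≫ relD f n = 0 := by
  have hG (k : ℕ) (x) : ((chains G).d (k + 1) k).hom (((chains G).d (k + 2) (k + 1)).hom x) = 0 :=
    congrArg (fun t => t.hom x) ((chains G).d_comp_d (k + 2) (k + 1) k)
  have hΓ (k : ℕ) (x) : ((chains Γ).d (k + 1) k).hom (((chains Γ).d (k + 2) (k + 1)).hom x) = 0 :=
    congrArg (fun t => t.hom x) ((chains Γ).d_comp_d (k + 2) (k + 1) k)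
  have hf (k : ℕ) (y) : ((chains G).d (k + 1) k).hom (((chainsMap f).f (k + 1)).hom y) =
      ((chainsMap f).f k).hom (((chains Γ).d (k + 1) k).hom y) :=
    congrArg (fun t => t.hom y) ((chainsMap f).comm (k + 1) k)
  ext1
  refine LinearMap.ext fun p => ?_
  obtain ⟨x, y⟩ : (chains G).X (n + 2) × (chains Γ).X (n + 1) := p
  cases n with
  | zero =>
    change ((chains G).d 1 0).hom (((chains G).d 2 1).hom x - ((chainsMap f).f 1).hom y) -
      ((chainsMap f).f 0).hom (-(((chains Γ).d 1 0).hom y)) = 0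
    rw [map_sub, map_neg, hG, hf]; abel
  | succ n =>
    refine Prod.ext ?_ ?_
    · change ((chains G).d (n + 2) (n + 1)).hom
          (((chains G).d (n + 3) (n + 2)).hom x - ((chainsMap f).f (n + 2)).hom y) -
        ((chainsMap f).f (n + 1)).hom (-(((chains Γ).d (n + 2) (n + 1)).hom y)) = 0
      rw [map_sub, map_neg, hG, hf]; abel
    · change -(((chains Γ).d (n + 1) n).hom (-(((chains Γ).d (n + 2) (n + 1)).hom y))) = 0
      rw [map_neg, hΓ]; simp

/-- The relative chain complex `C_*(G, Γ; ℤ)` of `f`, the mapping cone of `C_*(f)`. -/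
def relChains (f : Γ →* G) : ChainComplex (ModuleCat.{u} (ULift.{u} ℤ)) ℕ :=
  ChainComplex.of (relX f) (relD f) (relD_comp_relD f)

theorem relChains_d (f : Γ →* G) (n : ℕ) : (relChains f).d (n + 1) n = relD f n :=
  ChainComplex.of_d _ _ _

/-- The relative homology group `H_n(G, Γ) = H_n(G, Γ; ℤ)` of `f`. -/
abbrev relH (n : ℕ) (f : Γ →* G) : ModuleCat.{u} (ULift.{u} ℤ) :=
  (relChains f).homology n

/-- The inclusion `x ↦ (x, 0)` in degree `n`. -/
def relInclX (f : Γ →* G) : (n : ℕ) → ((chains G).X n ⟶ relX f n)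
  | 0 => 𝟙 _
  | _ + 1 => ModuleCat.ofHom (LinearMap.inl _ _ _)

/-- The inclusion `C_*(G) ⟶ C_*(G, Γ)`, `x ↦ (x, 0)`. -/
def relIncl (f : Γ →* G) : chains G ⟶ relChains f where
  f := relInclX f
  comm' i j hij := by
    obtain rfl : j + 1 = i := hij
    rw [relChains_d]
    ext1
    refine LinearMap.ext fun x => ?_
    cases j with
    | zero =>
      change ((chains G).d 1 0).hom x - ((chainsMap f).f 0).hom 0 = ((chains G).d 1 0).hom x
      simp
    | succ n =>
      refine Prod.ext ?_ ?_
      · change ((chains G).d (n + 2) (n + 1)).hom x - ((chainsMap f).f (n + 1)).hom 0 =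
          ((chains G).d (n + 2) (n + 1)).hom x
        simp
      · change -(((chains Γ).d (n + 1) n).hom 0) = 0
        simp

/-- The natural map `H_n(G) ⟶ H_n(G, Γ)`. -/
def toRelH (n : ℕ) (f : Γ →* G) : H n G ⟶ relH n f :=
  HomologicalComplex.homologyMap (relIncl f) n

section Functoriality

variable {Γ' G' : Type u} [Group Γ'] [Group G']

theorem chainsMap_square {f : Γ →* G} {f' : Γ' →* G'} {a : Γ →* Γ'} {b : G →* G'}
    (h : b.comp f = f'.comp a) (n : ℕ) (y : (chains Γ).X n) :
    ((chainsMap b).f n).hom (((chainsMap f).f n).hom y) =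
      ((chainsMap f').f n).hom (((chainsMap a).f n).hom y) := by
  have h1 : chainsMap f ≫ chainsMap b = chainsMap a ≫ chainsMap f' := by
    refine (groupHomology.chainsMap_comp f b (trivialZRes f) (trivialZRes b)).symm.trans
      (Eq.trans ?_ (groupHomology.chainsMap_comp a f' (trivialZRes a) (trivialZRes f')))
    exact groupHomology.chainsMap_congr h rfl
  exact congrArg (fun t => (t.f n).hom y) h1

/-- The map `(x, y) ↦ (b x, a y)` in degree `n`. -/
def relMapX (f : Γ →* G) (f' : Γ' →* G') (a : Γ →* Γ') (b : G →* G') :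
    (n : ℕ) → (relX f n ⟶ relX f' n)
  | 0 => (chainsMap b).f 0
  | n + 1 => ModuleCat.ofHom
      (LinearMap.prodMap ((chainsMap b).f (n + 1)).hom ((chainsMap a).f n).hom)

/-- The chain map `C_*(G, Γ) ⟶ C_*(G', Γ')` induced by a commutative square. -/
def relChainsMap {f : Γ →* G} {f' : Γ' →* G'} {a : Γ →* Γ'} {b : G →* G'}
    (h : b.comp f = f'.comp a) : relChains f ⟶ relChains f' where
  f := relMapX f f' a b
  comm' i j hij := by
    obtain rfl : j + 1 = i := hij
    rw [relChains_d, relChains_d]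
    have hb (k : ℕ) (x) : ((chains G').d (k + 1) k).hom (((chainsMap b).f (k + 1)).hom x) =
        ((chainsMap b).f k).hom (((chains G).d (k + 1) k).hom x) :=
      congrArg (fun t => t.hom x) ((chainsMap b).comm (k + 1) k)
    have ha (k : ℕ) (x) : ((chains Γ').d (k + 1) k).hom (((chainsMap a).f (k + 1)).hom x) =
        ((chainsMap a).f k).hom (((chains Γ).d (k + 1) k).hom x) :=
      congrArg (fun t => t.hom x) ((chainsMap a).comm (k + 1) k)
    ext1
    refine LinearMap.ext fun p => ?_
    obtain ⟨x, y⟩ : (chains G).X (j + 1) × (chains Γ).X j := p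
    cases j with
    | zero =>
      change ((chains G').d 1 0).hom (((chainsMap b).f 1).hom x) -
          ((chainsMap f').f 0).hom (((chainsMap a).f 0).hom y) =
        ((chainsMap b).f 0).hom (((chains G).d 1 0).hom x - ((chainsMap f).f 0).hom y)
      rw [map_sub, hb, chainsMap_square h]
    | succ n =>
      refine Prod.ext ?_ ?_
      · change ((chains G').d (n + 2) (n + 1)).hom (((chainsMap b).f (n + 2)).hom x) -
            ((chainsMap f').f (n + 1)).hom (((chainsMap a).f (n + 1)).hom y) =
          ((chainsMap b).f (n + 1)).hom
            (((chains G).d (n + 2) (n + 1)).hom x - ((chainsMap f).f (n + 1)).hom y)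
        rw [map_sub, hb, chainsMap_square h]
      · change -(((chains Γ').d (n + 1) n).hom (((chainsMap a).f (n + 1)).hom y)) =
          ((chainsMap a).f n).hom (-(((chains Γ).d (n + 1) n).hom y))
        rw [map_neg, ha]

/-- The homomorphism `H_n(G, Γ) ⟶ H_n(G', Γ')` induced by a commutative square. -/
def relHMap (n : ℕ) {f : Γ →* G} {f' : Γ' →* G'} {a : Γ →* Γ'} {b : G →* G'}
    (h : b.comp f = f'.comp a) : relH n f ⟶ relH n f' :=
  HomologicalComplex.homologyMap (relChainsMap h) n

end Functoriality

/-! ### Central `f`-extensions -/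

/-- A central `f`-extension of `G` with kernel the abelian group `A`: a central extension
`0 → A → M → G → 1` with a structure map `ψ : Γ → M` that factorizes `f`. -/
structure CentralFExtension (f : Γ →* G) (A : Type u) [AddCommGroup A] where
  M : Type u
  [group : Group M]
  ext : GroupExtension (Multiplicative A) M G
  central : ∀ a, ext.inl a ∈ Subgroup.center M
  ψ : Γ →* M
  comp_ψ : ext.rightHom.comp ψ = f

attribute [instance] CentralFExtension.group

namespace CentralFExtension

variable {f : Γ →* G} {A B : Type u} [AddCommGroup A] [AddCommGroup B]

/-- A map of central `f`-extensions: a map of extensions that is the identity on `G` and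
commutes with the structure maps. -/
structure Hom (E : CentralFExtension f A) (E' : CentralFExtension f B) where
  κ : A →+ B
  τ : E.M →* E'.M
  τ_inl : ∀ a : A, τ (E.ext.inl (Multiplicative.ofAdd a)) = E'.ext.inl (Multiplicative.ofAdd (κ a))
  rightHom_τ : ∀ m, E'.ext.rightHom (τ m) = E.ext.rightHom m
  τ_ψ : ∀ γ, τ (E.ψ γ) = E'.ψ γ

/-- Two central `f`-extensions with the same kernel `A` are equivalent if there is a map between
them which is the identity on `A`. -/
def Equivalent (E E' : CentralFExtension f A) : Prop :=
  ∃ h : E.Hom E', h.κ = AddMonoidHom.id A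

/-- The same central `f`-extension, with its kernel `A` identified with `B` through `e`. -/
def identifyKernel (E : CentralFExtension f A) (e : B ≃+ A) : CentralFExtension f B where
  M := E.M
  ext :=
    { inl := E.ext.inl.comp (AddMonoidHom.toMultiplicative e.toAddMonoidHom)
      rightHom := E.ext.rightHom
      inl_injective := E.ext.inl_injective.comp e.injective
      range_inl_eq_ker_rightHom := by
        rw [← E.ext.range_inl_eq_ker_rightHom, MonoidHom.range_comp]
        have : (AddMonoidHom.toMultiplicative e.toAddMonoidHom).range = ⊤ :=
          MonoidHom.range_eq_top.2 e.surjective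
        rw [this, MonoidHom.range_eq_map]
      rightHom_surjective := E.ext.rightHom_surjective }
  central _ := E.central _
  ψ := E.ψ
  comp_ψ := E.comp_ψ

/-! The class of a central `f`-extension in `H²(G, Γ; A)`, evaluated on `H₂(G, Γ)`. -/

/-- The kernel `A`, as the subgroup of `M` which it is. -/
def kerEquiv (E : CentralFExtension f A) : Multiplicative A ≃* E.ext.rightHom.ker :=
  (MonoidHom.ofInjective E.ext.inl_injective).trans
    (MulEquiv.subgroupCongr E.ext.range_inl_eq_ker_rightHom)

theorem inl_kerEquiv_symm (E : CentralFExtension f A) (m : E.ext.rightHom.ker) :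
    E.ext.inl (E.kerEquiv.symm m) = m :=
  congrArg Subtype.val (E.kerEquiv.apply_symm_apply m)

variable (E : CentralFExtension f A) (σ : E.ext.Section)

@[simp] theorem rightHom_ψ (γ : Γ) : E.ext.rightHom (E.ψ γ) = f γ :=
  DFunLike.congr_fun E.comp_ψ γ

/-- The `2`-cocycle of the section `σ : G → M`: `σ g * σ h = c(g, h) * σ (g * h)`. -/
def cocycle (g h : G) : A :=
  (E.kerEquiv.symm ⟨σ g * σ h * (σ (g * h))⁻¹, by simp [MonoidHom.mem_ker]⟩).toAdd

/-- The `1`-cochain of `Γ` that trivializes the pullback of the cocycle: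
`ψ γ = w(γ) * σ (f γ)`. -/
def cochain (γ : Γ) : A :=
  (E.kerEquiv.symm ⟨E.ψ γ * (σ (f γ))⁻¹, by simp [MonoidHom.mem_ker]⟩).toAdd

theorem cocycle_spec (g h : G) :
    E.ext.inl (Multiplicative.ofAdd (E.cocycle σ g h)) = σ g * σ h * (σ (g * h))⁻¹ :=
  E.inl_kerEquiv_symm _

theorem cochain_spec (γ : Γ) :
    E.ext.inl (Multiplicative.ofAdd (E.cochain σ γ)) = E.ψ γ * (σ (f γ))⁻¹ :=
  E.inl_kerEquiv_symm _

/-- The relative cochain `(c, w) ∈ C²(G; A) ⊕ C¹(Γ; A) = Hom(C₂(G, Γ), A)`. -/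
def relCochain : (relChains f).X 2 ⟶ ModuleCat.of (ULift.{u} ℤ) A :=
  ModuleCat.ofHom (X := (chains G).X 2 × (chains Γ).X 1) <| LinearMap.coprod
    (Finsupp.linearCombination (ULift.{u} ℤ) fun g : Fin 2 → G => E.cocycle σ (g 0) (g 1))
    (Finsupp.linearCombination (ULift.{u} ℤ) fun γ : Fin 1 → Γ => E.cochain σ (γ 0))

theorem cocycle_add (g h k : G) :
    E.cocycle σ g h + E.cocycle σ (g * h) k = E.cocycle σ h k + E.cocycle σ g (h * k) := by
  apply Multiplicative.ofAdd.injective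
  apply E.ext.inl_injective
  have hc := Subgroup.mem_center_iff.1 (E.central (Multiplicative.ofAdd (E.cocycle σ h k))) (σ g)
  rw [ofAdd_add, ofAdd_add, map_mul, map_mul]
  rw [cocycle_spec] at hc
  rw [cocycle_spec, cocycle_spec, cocycle_spec, cocycle_spec]
  calc σ g * σ h * (σ (g * h))⁻¹ * (σ (g * h) * σ k * (σ (g * h * k))⁻¹)
      = σ g * (σ h * σ k * (σ (h * k))⁻¹) * (σ (h * k) * (σ (g * h * k))⁻¹) := by group
    _ = _ := by rw [hc, mul_assoc g h k]; group

theorem cochain_mul (γ δ : Γ) :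
    E.cochain σ (γ * δ) = E.cochain σ γ + E.cochain σ δ + E.cocycle σ (f γ) (f δ) := by
  apply Multiplicative.ofAdd.injective
  apply E.ext.inl_injective
  have hc := Subgroup.mem_center_iff.1 (E.central (Multiplicative.ofAdd (E.cochain σ δ))) (σ (f γ))
  rw [ofAdd_add, ofAdd_add, map_mul, map_mul]
  rw [cochain_spec] at hc
  rw [cocycle_spec, cochain_spec, cochain_spec, cochain_spec, map_mul, map_mul]
  calc E.ψ γ * E.ψ δ * (σ (f γ * f δ))⁻¹
      = E.ψ γ * (σ (f γ))⁻¹ * (σ (f γ) * (E.ψ δ * (σ (f δ))⁻¹)) * σ (f δ) *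
          (σ (f γ * f δ))⁻¹ := by group
    _ = _ := by rw [hc]; group

/-- The boundary of a `2`-chain of `G`, evaluated on a function `b` on `G`. -/
theorem eval_d_two (b : G → A) (g : Fin 2 → G) (r : ULift.{u} ℤ) :
    Finsupp.linearCombination (ULift.{u} ℤ) (fun x : Fin 1 → G => b (x 0))
      (((chains G).d 2 1).hom (Finsupp.single g r)) =
    r • (b (g 1) - b (g 0 * g 1) + b (g 0)) := by
  rw [groupHomology.inhomogeneousChains.d_def]
  erw [groupHomology.inhomogeneousChains.d_single]
  simp only [map_add, map_sum, map_smul, Finsupp.linearCombination_single]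
  simp [Fin.sum_univ_two, Fin.contractNth, smul_add, smul_sub]
  abel

/-- The boundary of a `3`-chain of `G`, evaluated on a function `c` on `G × G`. -/
theorem eval_d_three (c : G → G → A) (g : Fin 3 → G) (r : ULift.{u} ℤ) :
    Finsupp.linearCombination (ULift.{u} ℤ) (fun x : Fin 2 → G => c (x 0) (x 1))
      (((chains G).d 3 2).hom (Finsupp.single g r)) =
    r • (c (g 1) (g 2) - c (g 0 * g 1) (g 2) + c (g 0) (g 1 * g 2) - c (g 0) (g 1)) := by
  rw [groupHomology.inhomogeneousChains.d_def]
  erw [groupHomology.inhomogeneousChains.d_single]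
  simp only [map_add, map_sum, map_smul, Finsupp.linearCombination_single]
  simp [Fin.sum_univ_three, Fin.contractNth, smul_add, smul_sub, pow_succ]
  abel

theorem d_comp_relCochain : (relChains f).d 3 2 ≫ E.relCochain σ = 0 := by
  rw [relChains_d]
  ext1
  refine LinearMap.ext fun p => ?_
  obtain ⟨x, y⟩ : (chains G).X 3 × (chains Γ).X 2 := p
  change Finsupp.linearCombination (ULift.{u} ℤ) (fun g : Fin 2 → G => E.cocycle σ (g 0) (g 1))
      (((chains G).d 3 2).hom x - ((chainsMap f).f 2).hom y) +
    Finsupp.linearCombination (ULift.{u} ℤ) (fun γ : Fin 1 → Γ => E.cochain σ (γ 0))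
      (-((chains Γ).d 2 1).hom y) = 0
  have hx : Finsupp.linearCombination (ULift.{u} ℤ)
      (fun g : Fin 2 → G => E.cocycle σ (g 0) (g 1)) (((chains G).d 3 2).hom x) = 0 := by
    induction x using Finsupp.induction_linear with
    | zero => simp
    | add x x' hx hx' => rw [map_add, map_add, hx, hx', add_zero]
    | single g r =>
      rw [eval_d_three]
      have := E.cocycle_add σ (g 0) (g 1) (g 2)
      rw [show E.cocycle σ (g 1) (g 2) - E.cocycle σ (g 0 * g 1) (g 2) +
        E.cocycle σ (g 0) (g 1 * g 2) - E.cocycle σ (g 0) (g 1) =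
        (E.cocycle σ (g 1) (g 2) + E.cocycle σ (g 0) (g 1 * g 2)) -
        (E.cocycle σ (g 0) (g 1) + E.cocycle σ (g 0 * g 1) (g 2)) by abel, this, sub_self,
        smul_zero]
  have hy : Finsupp.linearCombination (ULift.{u} ℤ)
      (fun g : Fin 2 → G => E.cocycle σ (g 0) (g 1)) (((chainsMap f).f 2).hom y) +
      Finsupp.linearCombination (ULift.{u} ℤ) (fun γ : Fin 1 → Γ => E.cochain σ (γ 0))
        (((chains Γ).d 2 1).hom y) = 0 := by
    induction y using Finsupp.induction_linear with
    | zero => simp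
    | add y y' hy hy' =>
      simp only [map_add]
      rw [add_add_add_comm, hy, hy', add_zero]
    | single g r =>
      rw [eval_d_two, E.cochain_mul]
      erw [groupHomology.chainsMap_f_single, Finsupp.linearCombination_single]
      change r • E.cocycle σ (f (g 0)) (f (g 1)) + _ = 0
      rw [← smul_add]
      convert smul_zero r
      abel
  rw [map_sub, map_neg, hx, zero_sub, ← neg_add, hy, neg_zero]

/-- The value of the class of `(c, w)` in `H²(G, Γ; A)` under
`H²(G, Γ; A) → Hom(H₂(G, Γ), A)`: it sends the class of a cycle `(x, y)` to `c(x) + w(y)`. -/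
def classHomOf : relH 2 f →+ A :=
  ((relChains f).homologyι 2 ≫ (relChains f).descOpcycles (E.relCochain σ) 3 (by simp)
    (E.d_comp_relCochain σ)).hom.toAddMonoidHom

theorem classHomOf_π (z : (relChains f).cycles 2) :
    E.classHomOf σ (((relChains f).homologyπ 2).hom z) =
      (E.relCochain σ).hom (((relChains f).iCycles 2).hom z) := by
  have : (relChains f).homologyπ 2 ≫ (relChains f).homologyι 2 ≫
      (relChains f).descOpcycles (E.relCochain σ) 3 (by simp) (E.d_comp_relCochain σ) =
      (relChains f).iCycles 2 ≫ E.relCochain σ := by simp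
  exact congrArg (fun t => t.hom z) this

/-- The choice of the section does not matter. -/
theorem classHomOf_eq (σ σ' : E.ext.Section) : E.classHomOf σ = E.classHomOf σ' := by
  let b (g : G) : A :=
    (E.kerEquiv.symm ⟨σ g * (σ' g)⁻¹, by simp [MonoidHom.mem_ker]⟩).toAdd
  have hb (g : G) : E.ext.inl (Multiplicative.ofAdd (b g)) = σ g * (σ' g)⁻¹ :=
    E.inl_kerEquiv_symm _
  have hbc (g : G) (m : E.M) : m * (σ g * (σ' g)⁻¹) = σ g * (σ' g)⁻¹ * m := by
    rw [← hb]; exact Subgroup.mem_center_iff.1 (E.central _) m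
  have h1 (g h : G) : E.cocycle σ g h = E.cocycle σ' g h + (b h - b (g * h) + b g) := by
    rw [show E.cocycle σ' g h + (b h - b (g * h) + b g) =
      b g + b h + E.cocycle σ' g h - b (g * h) by abel, eq_sub_iff_add_eq]
    apply Multiplicative.ofAdd.injective
    apply E.ext.inl_injective
    simp only [ofAdd_add, map_mul, hb, cocycle_spec]
    calc σ g * σ h * (σ (g * h))⁻¹ * (σ (g * h) * (σ' (g * h))⁻¹)
        = σ g * (σ' g)⁻¹ * (σ' g * (σ h * (σ' h)⁻¹)) * σ' h * (σ' (g * h))⁻¹ := by group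
      _ = _ := by rw [hbc]; group
  have h2 (γ : Γ) : E.cochain σ γ = E.cochain σ' γ - b (f γ) := by
    rw [eq_sub_iff_add_eq]
    apply Multiplicative.ofAdd.injective
    apply E.ext.inl_injective
    simp only [ofAdd_add, map_mul, hb, cochain_spec]
    group
  ext x
  obtain ⟨z, rfl⟩ := (ModuleCat.epi_iff_surjective ((relChains f).homologyπ 2)).1 inferInstance x
  erw [classHomOf_π, classHomOf_π]
  have hz : (relD f 1).hom (((relChains f).iCycles 2).hom z) = 0 := by
    rw [← relChains_d]
    exact congrArg (fun t => t.hom z) ((relChains f).iCycles_d 2 1)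
  generalize ((relChains f).iCycles 2).hom z = p at hz ⊢
  obtain ⟨x, y⟩ : (chains G).X 2 × (chains Γ).X 1 := p
  replace hz : ((chains G).d 2 1).hom x - ((chainsMap f).f 1).hom y = 0 := congrArg Prod.fst hz
  change Finsupp.linearCombination (ULift.{u} ℤ) (fun g : Fin 2 → G => E.cocycle σ (g 0) (g 1)) x +
      Finsupp.linearCombination (ULift.{u} ℤ) (fun γ : Fin 1 → Γ => E.cochain σ (γ 0)) y =
    Finsupp.linearCombination (ULift.{u} ℤ) (fun g : Fin 2 → G => E.cocycle σ' (g 0) (g 1)) x +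
      Finsupp.linearCombination (ULift.{u} ℤ) (fun γ : Fin 1 → Γ => E.cochain σ' (γ 0)) y
  have hx : Finsupp.linearCombination (ULift.{u} ℤ)
        (fun g : Fin 2 → G => E.cocycle σ (g 0) (g 1)) x =
      Finsupp.linearCombination (ULift.{u} ℤ)
        (fun g : Fin 2 → G => E.cocycle σ' (g 0) (g 1)) x +
      Finsupp.linearCombination (ULift.{u} ℤ) (fun g : Fin 1 → G => b (g 0))
        (((chains G).d 2 1).hom x) := by
    clear hz
    induction x using Finsupp.induction_linear with
    | zero => simp
    | add x x' hx hx' => simp only [map_add]; rw [hx, hx']; abel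
    | single g r =>
      rw [eval_d_two, Finsupp.linearCombination_single, Finsupp.linearCombination_single, h1,
        smul_add]
  have hy : Finsupp.linearCombination (ULift.{u} ℤ) (fun γ : Fin 1 → Γ => E.cochain σ (γ 0)) y =
      Finsupp.linearCombination (ULift.{u} ℤ) (fun γ : Fin 1 → Γ => E.cochain σ' (γ 0)) y -
      Finsupp.linearCombination (ULift.{u} ℤ) (fun g : Fin 1 → G => b (g 0))
        (((chainsMap f).f 1).hom y) := by
    clear hz
    induction y using Finsupp.induction_linear with
    | zero => simp
    | add y y' hy hy' => simp only [map_add]; rw [hy, hy']; abel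
    | single g r =>
      erw [groupHomology.chainsMap_f_single, Finsupp.linearCombination_single,
        Finsupp.linearCombination_single, Finsupp.linearCombination_single, h2, smul_sub]
      rfl
  rw [hx, hy, sub_eq_zero.1 hz]
  abel

/-- The element of `Hom(H₂(G, Γ), A)` that corresponds to the central `f`-extension `E`. -/
def classHom : relH 2 f →+ A :=
  E.classHomOf ⟨Function.surjInv E.ext.rightHom_surjective,
    Function.rightInverse_surjInv E.ext.rightHom_surjective⟩

/-- `E`, with kernel `H₂(G, Γ)`, is the universal central `f`-extension: it corresponds to the
identity map of `H₂(G, Γ)`. -/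
def IsUniversal (E : CentralFExtension f (relH 2 f)) : Prop :=
  E.classHom = AddMonoidHom.id (relH 2 f)

end CentralFExtension

/-! ### The extension `K/[K, Γ] → Γ/[K, Γ] → G` -/

/-- `K/[K, Γ]`, where `K` is the kernel of `f`. -/
abbrev KerMod (f : Γ →* G) : Type u :=
  f.ker ⧸ (⁅f.ker, (⊤ : Subgroup Γ)⁆).subgroupOf f.ker

instance (f : Γ →* G) : CommGroup (KerMod f) where
  mul_comm x y := by
    obtain ⟨a, rfl⟩ := QuotientGroup.mk_surjective x
    obtain ⟨b, rfl⟩ := QuotientGroup.mk_surjective y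
    refine QuotientGroup.eq.2 (Subgroup.mem_subgroupOf.2 ?_)
    have h := Subgroup.commutator_mem_commutator (H₁ := f.ker) (H₂ := (⊤ : Subgroup Γ))
      (inv_mem b.2) (Subgroup.mem_top ((a : Γ)⁻¹))
    have e : (((a * b)⁻¹ * (b * a) : f.ker) : Γ) =
        (b : Γ)⁻¹ * (a : Γ)⁻¹ * ((b : Γ)⁻¹)⁻¹ * ((a : Γ)⁻¹)⁻¹ := by
      simp [mul_assoc]
    rw [e]; exact h

/-- The inclusion `K/[K, Γ] → Γ/[K, Γ]`. -/
def kerModIncl (f : Γ →* G) : KerMod f →* Γ ⧸ ⁅f.ker, (⊤ : Subgroup Γ)⁆ :=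
  QuotientGroup.map _ _ f.ker.subtype le_rfl

theorem kerModIncl_injective (f : Γ →* G) : Function.Injective (kerModIncl f) := by
  rw [injective_iff_map_eq_one]
  intro x hx
  obtain ⟨a, rfl⟩ := QuotientGroup.mk_surjective x
  exact (QuotientGroup.eq_one_iff a).2
    (Subgroup.mem_subgroupOf.2 ((QuotientGroup.eq_one_iff (a : Γ)).1 hx))

theorem kerModIncl_mem_center (f : Γ →* G) (x : KerMod f) :
    kerModIncl f x ∈ Subgroup.center (Γ ⧸ ⁅f.ker, (⊤ : Subgroup Γ)⁆) := by
  obtain ⟨a, rfl⟩ := QuotientGroup.mk_surjective x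
  refine Subgroup.mem_center_iff.2 fun y => ?_
  obtain ⟨b, rfl⟩ := QuotientGroup.mk_surjective y
  refine QuotientGroup.eq.2 ?_
  have h := Subgroup.commutator_mem_commutator (H₁ := f.ker) (H₂ := (⊤ : Subgroup Γ))
    (inv_mem a.2) (Subgroup.mem_top (b⁻¹))
  have e : (b * (a : Γ))⁻¹ * ((a : Γ) * b) =
      (a : Γ)⁻¹ * b⁻¹ * ((a : Γ)⁻¹)⁻¹ * (b⁻¹)⁻¹ := by
    simp [mul_assoc]
  change (b * (a : Γ))⁻¹ * ((a : Γ) * b) ∈ _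
  rw [e]; exact h

theorem commutator_ker_le (f : Γ →* G) : ⁅f.ker, (⊤ : Subgroup Γ)⁆ ≤ f.ker :=
  Subgroup.commutator_le_left _ _

/-- The central `f`-extension `K/[K, Γ] → Γ/[K, Γ] → G` of a surjection `f : Γ → G` with
kernel `K`, with the quotient map `Γ → Γ/[K, Γ]` as the structure map. -/
def quotientExtension (f : Γ →* G) (hf : Function.Surjective f) :
    CentralFExtension f (Additive (KerMod f)) where
  M := Γ ⧸ ⁅f.ker, (⊤ : Subgroup Γ)⁆
  ext :=
    { inl := (kerModIncl f).comp (MulEquiv.multiplicativeAdditive (KerMod f)).toMonoidHom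
      rightHom := QuotientGroup.lift _ f (commutator_ker_le f)
      inl_injective := kerModIncl_injective f
      range_inl_eq_ker_rightHom := by
        ext x
        obtain ⟨b, rfl⟩ := QuotientGroup.mk_surjective x
        constructor
        · rintro ⟨y, hy⟩
          obtain ⟨a, ha⟩ := QuotientGroup.mk_surjective (Additive.toMul (Multiplicative.toAdd y))
          rw [← hy]
          change QuotientGroup.lift _ f _ (kerModIncl f (Additive.toMul (Multiplicative.toAdd y))) = 1
          rw [← ha]
          exact a.2
        · intro hb
          exact ⟨Multiplicative.ofAdd (Additive.ofMul (QuotientGroup.mk ⟨b, hb⟩)), rfl⟩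
      rightHom_surjective := fun g => by
        obtain ⟨γ, rfl⟩ := hf g
        exact ⟨QuotientGroup.mk γ, rfl⟩ }
  central _ := kerModIncl_mem_center f _
  ψ := QuotientGroup.mk' _
  comp_ψ := rfl

/-- The homomorphism `K/[K, Γ] → K'/[K', Γ']` induced by a commutative square. -/
def kerModMap {Γ' G' : Type u} [Group Γ'] [Group G'] {f : Γ →* G} {f' : Γ' →* G'} {a : Γ →* Γ'}
    {b : G →* G'} (h : b.comp f = f'.comp a) : KerMod f →* KerMod f' :=
  QuotientGroup.map _ _
    ((a.comp f.ker.subtype).codRestrict f'.ker fun k => by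
      have := DFunLike.congr_fun h (k : Γ)
      simpa [MonoidHom.mem_ker, MonoidHom.mem_ker.1 k.2, eq_comm] using this)
    (by
      intro k hk
      have hle : f.ker.map a ≤ f'.ker := by
        rintro _ ⟨k, hk, rfl⟩
        have := DFunLike.congr_fun h k
        simpa [MonoidHom.mem_ker, MonoidHom.mem_ker.1 hk, eq_comm] using this
      have h1 : (⁅f.ker, (⊤ : Subgroup Γ)⁆).map a ≤ ⁅f'.ker, (⊤ : Subgroup Γ')⁆ := by
        rw [Subgroup.map_commutator]
        exact Subgroup.commutator_mono hle le_top
      exact h1 ⟨k, hk, rfl⟩)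

/-- The homomorphism `K/[K, Γ] → Γ_ab` induced by the inclusion of `K` in `Γ`. -/
def kerModToAb (f : Γ →* G) : KerMod f →* Abelianization Γ :=
  QuotientGroup.map _ _ f.ker.subtype
    (fun _ hk => Subgroup.commutator_mono le_top le_rfl (Subgroup.mem_subgroupOf.1 hk))

/-- `(K ∩ [Γ, Γ])/[K, Γ]`, where `K` is the kernel of `f`. -/
abbrev HopfMod (f : Γ →* G) : Type u :=
  (f.ker ⊓ commutator Γ : Subgroup Γ) ⧸
    (⁅f.ker, (⊤ : Subgroup Γ)⁆).subgroupOf (f.ker ⊓ commutator Γ)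

/-- The inclusion `(K ∩ [Γ, Γ])/[K, Γ] → K/[K, Γ]`. -/
def hopfModIncl (f : Γ →* G) : HopfMod f →* KerMod f :=
  QuotientGroup.map _ _ (Subgroup.inclusion inf_le_left) le_rfl

end

end RelativeSchur

open RelativeSchur

/-! Since `f` is surjective, so is `C_2(f)`. A relative `2`-cycle `(x, y)` with `x = f z` is
therefore homologous to `(0, y - d z)`, and `H₂(G, Γ)` is generated by the classes `relDiff` of `(0,
[γ] - [δ])` with `f γ = f δ`. Two facts about these generators carry the proof. They are additive
under products of pairs (`relDiff_mul`), and the homomorphism corresponding to any central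
`f`-extension sends such a class to `ψ γ * (ψ δ)⁻¹`, with no section left in the formula
(`classHom_relDiff`).

The isomorphism `θ_f` is the homomorphism corresponding to `Γ/[K, Γ]`, which sends a generator to
the class of `γ δ⁻¹`. Its inverse is `k ↦ [(0, [k] - [1])]`; by additivity this is a homomorphism
that kills `[K, Γ]`. With this choice of `θ_f` the quotient extension corresponds to the identity.
For any central `f`-extension, `ψ` maps `K` into the center, so it kills `[K, Γ]` and induces a map
out of the quotient extension; this map is unique because `Γ → Γ/[K, Γ]` is onto.

The five term sequence comes from the long exact sequence of the cone: under `θ_f` the connecting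
map becomes `K/[K, Γ] → Γ_ab`. Hopf's formula follows from `H₂(F) = 0`, which holds because central
extensions of a free group split. -/

namespace RelativeSchur

noncomputable section

/-! ### Homology classes of explicit cycles. -/

section CycleClass

variable {R : Type u} [Ring R] (C : ChainComplex (ModuleCat.{u} R) ℕ) (n : ℕ)

/-- The elements of degree `n + 1` killed by the differential, as elements of `C.cycles`. -/
def toCyclesObj : ModuleCat.of R (LinearMap.ker (C.d (n + 1) n).hom) ⟶ C.cycles (n + 1) :=
  C.liftCycles (ModuleCat.ofHom (LinearMap.ker (C.d (n + 1) n).hom).subtype) n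
    (ChainComplex.next_nat_succ n) (by
      ext x
      exact x.2)

theorem iCycles_toCyclesObj (z : LinearMap.ker (C.d (n + 1) n).hom) :
    (C.iCycles (n + 1)).hom ((toCyclesObj C n).hom z) = z :=
  congrArg (fun t : ModuleCat.of R (LinearMap.ker (C.d (n + 1) n).hom) ⟶ _ => t.hom z)
    (C.liftCycles_i _ n (ChainComplex.next_nat_succ n) _)

/-- The homology class of a cycle. -/
def cycleClass : LinearMap.ker (C.d (n + 1) n).hom →ₗ[R] C.homology (n + 1) :=
  (C.homologyπ (n + 1)).hom ∘ₗ (toCyclesObj C n).hom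

theorem iCycles_injective : Function.Injective (C.iCycles (n + 1)).hom :=
  (ModuleCat.mono_iff_injective _).1 inferInstance

theorem cycleClass_surjective : Function.Surjective (cycleClass C n) := by
  intro x
  obtain ⟨z, rfl⟩ := (ModuleCat.epi_iff_surjective (C.homologyπ (n + 1))).1 inferInstance x
  refine ⟨⟨(C.iCycles (n + 1)).hom z,
    congrArg (fun t : C.cycles (n + 1) ⟶ _ => t.hom z) (C.iCycles_d (n + 1) n)⟩, ?_⟩
  exact congrArg (C.homologyπ (n + 1)).hom
    (iCycles_injective C n (iCycles_toCyclesObj C n _))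

/-- Homology is the cokernel of `C.toCycles`, and equality of cycles can be tested in the chain
module because `C.iCycles` is injective. -/
theorem cycleClass_eq_zero_iff (z : LinearMap.ker (C.d (n + 1) n).hom) :
    cycleClass C n z = 0 ↔ ∃ w, (C.d (n + 2) (n + 1)).hom w = z := by
  have hex : (ShortComplex.mk _ _ (C.toCycles_comp_homologyπ (n + 2) (n + 1))).Exact :=
    ShortComplex.exact_of_g_is_cokernel _ (C.homologyIsCokernel (n + 2) (n + 1) (by simp))
  have hi (w) : (C.iCycles (n + 1)).hom ((C.toCycles (n + 2) (n + 1)).hom w) =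
      (C.d (n + 2) (n + 1)).hom w :=
    congrArg (fun t => t.hom w) (C.toCycles_i (n + 2) (n + 1))
  constructor
  · intro h
    obtain ⟨w, hw⟩ := (ShortComplex.moduleCat_exact_iff _).1 hex ((toCyclesObj C n).hom z) h
    refine ⟨w, ?_⟩
    rw [← hi, ← iCycles_toCyclesObj]
    exact congrArg _ hw
  · rintro ⟨w, hw⟩
    have : (toCyclesObj C n).hom z = (C.toCycles (n + 2) (n + 1)).hom w :=
      iCycles_injective C n (by rw [hi, hw, iCycles_toCyclesObj])
    change (C.homologyπ (n + 1)).hom ((toCyclesObj C n).hom z) = 0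
    rw [this]
    exact congrArg (fun t => t.hom w) (C.toCycles_comp_homologyπ (n + 2) (n + 1))

theorem homologyMap_cycleClass {C} {D : ChainComplex (ModuleCat.{u} R) ℕ} (φ : C ⟶ D)
    (z : LinearMap.ker (C.d (n + 1) n).hom) (w : LinearMap.ker (D.d (n + 1) n).hom)
    (h : (φ.f (n + 1)).hom z = w) :
    (HomologicalComplex.homologyMap φ (n + 1)).hom (cycleClass C n z) = cycleClass D n w := by
  have h1 := congrArg (fun t => t.hom ((toCyclesObj C n).hom z))
    (HomologicalComplex.homologyπ_naturality φ (n + 1))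
  refine h1.trans (congrArg (D.homologyπ (n + 1)).hom (iCycles_injective D n ?_))
  rw [iCycles_toCyclesObj, ← h]
  refine (congrArg (fun t => t.hom ((toCyclesObj C n).hom z))
    (HomologicalComplex.cyclesMap_i φ (n + 1))).trans ?_
  exact congrArg (φ.f (n + 1)).hom (iCycles_toCyclesObj C n z)

end CycleClass

/-! ### Inhomogeneous chains in low degrees. -/

variable {Γ G : Type u} [Group Γ] [Group G]

/-- The basis element `[g]` of `C_1(G; ℤ)`. -/
def cell₁ (g : G) : (chains G).X 1 := Finsupp.single (fun _ : Fin 1 => g) (1 : ULift.{u} ℤ)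

/-- The basis element `[g | h]` of `C_2(G; ℤ)`. -/
def cell₂ (g h : G) : (chains G).X 2 := Finsupp.single ![g, h] (1 : ULift.{u} ℤ)

theorem single_eq_zsmul {α : Type*} (g : α) (r : ULift.{u} ℤ) :
    Finsupp.single g r = r.down • Finsupp.single g (1 : ULift.{u} ℤ) := by
  ext x
  by_cases h : g = x <;> simp [h]

/-- Integer multiples replace `ULift ℤ`-multiples, so that `map_zsmul` applies to maps that are only
additive, and statements reduce to the cells. -/
theorem chains_X_induction {n : ℕ} {p : (chains G).X n → Prop} (x : (chains G).X n)
    (h0 : p 0) (hadd : ∀ x y, p x → p y → p (x + y))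
    (hsingle : ∀ g : Fin n → G, ∀ r : ℤ, p (r • (Finsupp.single g (1 : ULift.{u} ℤ) :
      (Fin n → G) →₀ ULift.{u} ℤ))) : p x := by
  refine Finsupp.induction_linear x h0 hadd fun g r => ?_
  rw [single_eq_zsmul]
  exact hsingle g r.down

theorem cell₁_eq (g : Fin 1 → G) : (Finsupp.single g (1 : ULift.{u} ℤ) :
      (Fin 1 → G) →₀ ULift.{u} ℤ) = cell₁ (g 0) := by
  refine congrArg (fun t => Finsupp.single t (1 : ULift.{u} ℤ)) ?_
  ext i
  rw [Subsingleton.elim i 0]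

theorem cell₂_eq (g : Fin 2 → G) : (Finsupp.single g (1 : ULift.{u} ℤ) :
      (Fin 2 → G) →₀ ULift.{u} ℤ) = cell₂ (g 0) (g 1) := by
  refine congrArg (fun t => Finsupp.single t (1 : ULift.{u} ℤ)) ?_
  ext i
  fin_cases i <;> rfl

theorem d_cell₂ (g h : G) :
    ((chains G).d 2 1).hom (cell₂ g h) = cell₁ h - cell₁ (g * h) + cell₁ g := by
  rw [cell₂, groupHomology.inhomogeneousChains.d_def]
  erw [groupHomology.inhomogeneousChains.d_single]
  simp [Fin.sum_univ_two]
  rw [cell₁_eq, cell₁_eq, cell₁_eq]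
  simp [Fin.contractNth]
  abel

theorem d_three_single (g : Fin 3 → G) :
    ((chains G).d 3 2).hom (Finsupp.single g (1 : ULift.{u} ℤ)) =
      cell₂ (g 1) (g 2) - cell₂ (g 0 * g 1) (g 2) + cell₂ (g 0) (g 1 * g 2) -
        cell₂ (g 0) (g 1) := by
  rw [groupHomology.inhomogeneousChains.d_def]
  erw [groupHomology.inhomogeneousChains.d_single]
  simp [Fin.sum_univ_three, pow_succ]
  rw [cell₂_eq, cell₂_eq, cell₂_eq, cell₂_eq]
  simp [Fin.contractNth]
  abel

theorem chainsMap_cell₁ (f : Γ →* G) (γ : Γ) :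
    ((chainsMap f).f 1).hom (cell₁ γ) = cell₁ (f γ) :=
  groupHomology.chainsMap_f_single f (trivialZRes f) 1 _ _

theorem chainsMap_cell₂ (f : Γ →* G) (γ δ : Γ) :
    ((chainsMap f).f 2).hom (cell₂ γ δ) = cell₂ (f γ) (f δ) :=
  (groupHomology.chainsMap_f_single f (trivialZRes f) 2 _ _).trans (cell₂_eq _)

/-- The action on the coefficients is trivial, so the two faces of `[g]` cancel. -/
theorem d_one_eq_zero (x : (chains G).X 1) : ((chains G).d 1 0).hom x = 0 := by
  refine chains_X_induction (p := fun x => ((chains G).d 1 0).hom x = 0) x (map_zero _) (fun x y hx hy => by rw [map_add, hx, hy, add_zero])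
    fun g r => ?_
  rw [cell₁_eq, map_zsmul, cell₁, groupHomology.inhomogeneousChains.d_def]
  erw [groupHomology.inhomogeneousChains.d_single]
  simp
  rw [← sub_eq_add_neg, sub_eq_zero]
  congr 1
  exact Subsingleton.elim _ _

/-! ### Relative `2`-cycles and generators of `H₂(G, Γ)`. -/

theorem relChains_d_apply (f : Γ →* G) (x : (chains G).X 2) (y : (chains Γ).X 1) :
    ((relChains f).d 2 1).hom ((x, y) : (chains G).X 2 × (chains Γ).X 1) =
      ((((chains G).d 2 1).hom x - ((chainsMap f).f 1).hom y, 0) :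
        (chains G).X 1 × (chains Γ).X 0) := by
  rw [relChains_d]
  refine Prod.ext rfl ?_
  change -(((chains Γ).d 1 0).hom y) = 0
  rw [d_one_eq_zero, neg_zero]

theorem relChains_d_three_apply (f : Γ →* G) (x : (chains G).X 3) (y : (chains Γ).X 2) :
    ((relChains f).d 3 2).hom ((x, y) : (chains G).X 3 × (chains Γ).X 2) =
      ((((chains G).d 3 2).hom x - ((chainsMap f).f 2).hom y, -((chains Γ).d 2 1).hom y) :
        (chains G).X 2 × (chains Γ).X 1) := by
  rw [relChains_d]; rfl

/-- The map `y ↦ (0, y)` from the relative cycles with vanishing first component to the relative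
cycles. -/
def kerToRelCycles (f : Γ →* G) : LinearMap.ker ((chainsMap f).f 1).hom →ₗ[ULift.{u} ℤ]
    LinearMap.ker ((relChains f).d 2 1).hom :=
  LinearMap.codRestrict _ (LinearMap.inr (ULift.{u} ℤ) ((chains G).X 2) ((chains Γ).X 1) ∘ₗ
    (LinearMap.ker ((chainsMap f).f 1).hom).subtype) fun y => by
      refine (relChains_d_apply f 0 y).trans (Prod.ext ?_ rfl)
      change ((chains G).d 2 1).hom 0 - ((chainsMap f).f 1).hom y = 0
      rw [map_zero, y.2, sub_zero]

/-- The class of the relative cycle `(0, y)`. -/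
def relOfKer (f : Γ →* G) : LinearMap.ker ((chainsMap f).f 1).hom →ₗ[ULift.{u} ℤ] relH 2 f :=
  cycleClass (relChains f) 1 ∘ₗ kerToRelCycles f

theorem chainsMap_two_surjective (f : Γ →* G) (hf : Function.Surjective f) :
    Function.Surjective ((chainsMap f).f 2).hom := by
  intro x
  refine chains_X_induction (p := fun x => ∃ y, ((chainsMap f).f 2).hom y = x) x ⟨0, map_zero _⟩
    ?_ fun g r => ?_
  · rintro _ _ ⟨y, rfl⟩ ⟨y', rfl⟩
    exact ⟨y + y', map_add _ _ _⟩
  · obtain ⟨γ, hγ⟩ := hf (g 0)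
    obtain ⟨δ, hδ⟩ := hf (g 1)
    exact ⟨r • cell₂ γ δ, by rw [map_zsmul, chainsMap_cell₂, cell₂_eq, hγ, hδ]⟩

/-- Lift the first component of a cycle `(x, y)` to `z` with `f z = x`. Adding the boundary `d (0,
z) = (-f z, -d z)` gives `(0, y - d z)`. -/
theorem relOfKer_surjective (f : Γ →* G) (hf : Function.Surjective f) :
    Function.Surjective (relOfKer f) := by
  intro c
  obtain ⟨⟨p, hp⟩, rfl⟩ := cycleClass_surjective (relChains f) 1 c
  obtain ⟨x, y⟩ : (chains G).X 2 × (chains Γ).X 1 := p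
  obtain ⟨z, rfl⟩ := chainsMap_two_surjective f hf x
  have hd := congrArg Prod.fst ((relChains_d_apply f _ y).symm.trans hp)
  change ((chains G).d 2 1).hom (((chainsMap f).f 2).hom z) - ((chainsMap f).f 1).hom y = 0 at hd
  have hc : ((chains G).d 2 1).hom (((chainsMap f).f 2).hom z) =
      ((chainsMap f).f 1).hom (((chains Γ).d 2 1).hom z) :=
    congrArg (fun t => t.hom z) ((chainsMap f).comm 2 1)
  refine ⟨⟨y - ((chains Γ).d 2 1).hom z, ?_⟩, ?_⟩
  · rw [LinearMap.mem_ker, map_sub, ← hc, ← neg_sub, hd, neg_zero]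
  · rw [← sub_eq_zero]
    refine (map_sub (cycleClass (relChains f) 1) _ _).symm.trans ?_
    rw [cycleClass_eq_zero_iff]
    refine ⟨((0, z) : (chains G).X 3 × (chains Γ).X 2), (relChains_d_three_apply f 0 z).trans ?_⟩
    refine Prod.ext ?_ ?_
    · change ((chains G).d 3 2).hom 0 - ((chainsMap f).f 2).hom z = 0 - ((chainsMap f).f 2).hom z
      rw [map_zero]
    · change -((chains Γ).d 2 1).hom z = y - ((chains Γ).d 2 1).hom z - y
      abel

/-- The cycle `[γ] - [δ]` in the kernel of `C_1(f)`. -/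
def kerDiff (f : Γ →* G) (γ δ : Γ) (h : f γ = f δ) : LinearMap.ker ((chainsMap f).f 1).hom :=
  ⟨cell₁ γ - cell₁ δ, by
    rw [LinearMap.mem_ker, map_sub, chainsMap_cell₁, chainsMap_cell₁, h, sub_self]⟩

theorem kerDiff_closure (f : Γ →* G) (hf : Function.Surjective f) :
    AddSubgroup.closure {z | ∃ γ δ h, z = kerDiff f γ δ h} = ⊤ := by
  obtain ⟨s, hs⟩ := hf.hasRightInverse
  -- A set-theoretic section suffices to split `C_1(f)`. The difference `y - S (f y)` is a
  -- combination of the `[γ] - [s (f γ)]`, and it equals `y` when `y` lies in the kernel.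
  let S : (chains G).X 1 →+ (chains Γ).X 1 :=
    (Finsupp.mapDomain.addMonoidHom (M := ULift.{u} ℤ)
      (fun g : Fin 1 → G => fun _ : Fin 1 => s (g 0)))
  have hS (g : G) : S (cell₁ g) = cell₁ (s g) := Finsupp.mapDomain_single
  rw [eq_top_iff]
  rintro ⟨y, hy⟩ -
  let N : AddSubgroup ((chains Γ).X 1) :=
    (AddSubgroup.closure {z | ∃ γ δ h, z = kerDiff f γ δ h}).map
      (LinearMap.ker ((chainsMap f).f 1).hom).subtype.toAddMonoidHom
  have key : ∀ y : (chains Γ).X 1, y - S (((chainsMap f).f 1).hom y) ∈ N := by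
    intro y
    refine chains_X_induction (p := fun y : (chains Γ).X 1 =>
      y - S (((chainsMap f).f 1).hom y) ∈ N) y ?_ ?_ fun g r => ?_
    · rw [map_zero, map_zero, sub_zero]; exact zero_mem _
    · intro y y' hy hy'
      rw [map_add, map_add, add_sub_add_comm]
      exact add_mem hy hy'
    · rw [cell₁_eq, map_zsmul, chainsMap_cell₁, map_zsmul, hS, ← zsmul_sub]
      exact N.zsmul_mem ⟨kerDiff f (g 0) (s (f (g 0))) (hs _).symm,
        AddSubgroup.subset_closure ⟨_, _, _, rfl⟩, rfl⟩ r
  obtain ⟨z, hz, hzy⟩ := key y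
  rw [LinearMap.mem_ker.1 hy, map_zero, sub_zero] at hzy
  exact (Subtype.ext hzy : z = ⟨y, hy⟩) ▸ hz

/-- The class of the relative cycle `(0, [γ] - [δ])`. -/
def relDiff (f : Γ →* G) (γ δ : Γ) (h : f γ = f δ) : relH 2 f := relOfKer f (kerDiff f γ δ h)

theorem relDiff_closure (f : Γ →* G) (hf : Function.Surjective f) :
    AddSubgroup.closure {z | ∃ γ δ h, z = relDiff f γ δ h} = ⊤ := by
  have := congrArg (AddSubgroup.map (relOfKer f).toAddMonoidHom) (kerDiff_closure f hf)
  rw [AddMonoidHom.map_closure, ← AddMonoidHom.range_eq_map,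
    AddMonoidHom.range_eq_top.2 (relOfKer_surjective f hf)] at this
  rw [← this]
  congr 1
  ext z
  constructor
  · rintro ⟨γ, δ, h, rfl⟩
    exact ⟨_, ⟨γ, δ, h, rfl⟩, rfl⟩
  · rintro ⟨_, ⟨γ, δ, h, rfl⟩, rfl⟩
    exact ⟨γ, δ, h, rfl⟩

/-- Identities between homomorphisms out of `H₂(G, Γ)` are reduced to generators by this lemma, so
that `classHom_relDiff` can be used in place of cocycles. -/
theorem relH_two_hom_ext {f : Γ →* G} (hf : Function.Surjective f) {A : Type*} [AddCommGroup A]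
    {φ χ : relH 2 f →+ A} (H : ∀ γ δ h, φ (relDiff f γ δ h) = χ (relDiff f γ δ h)) : φ = χ := by
  refine AddMonoidHom.eq_of_eqOn_dense (relDiff_closure f hf) ?_
  rintro _ ⟨γ, δ, h, rfl⟩
  exact H γ δ h

theorem relDiff_self (f : Γ →* G) (γ : Γ) (h : f γ = f γ) : relDiff f γ γ h = 0 := by
  have : kerDiff f γ γ h = 0 := Subtype.ext (sub_self _)
  rw [relDiff, this, map_zero]

/-- The relation is the boundary of `(0, [γ | γ'] - [δ | δ'])`: its image in `C_2(G)` vanishes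
because the two cells have the same image. -/
theorem relDiff_mul (f : Γ →* G) (γ δ γ' δ' : Γ) (h : f γ = f δ) (h' : f γ' = f δ')
    (hm : f (γ * γ') = f (δ * δ')) :
    relDiff f (γ * γ') (δ * δ') hm = relDiff f γ δ h + relDiff f γ' δ' h' := by
  rw [← sub_eq_zero, relDiff, relDiff, relDiff, ← map_add, ← map_sub]
  refine (cycleClass_eq_zero_iff _ _ _).2
    ⟨((0, cell₂ γ γ' - cell₂ δ δ') : (chains G).X 3 × (chains Γ).X 2),
      (relChains_d_three_apply f _ _).trans (Prod.ext ?_ ?_)⟩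
  · change ((chains G).d 3 2).hom 0 - ((chainsMap f).f 2).hom (cell₂ γ γ' - cell₂ δ δ') = 0
    rw [map_zero, map_sub, chainsMap_cell₂, chainsMap_cell₂, h, h', sub_self, sub_zero]
  · change -((chains Γ).d 2 1).hom (cell₂ γ γ' - cell₂ δ δ') =
      cell₁ (γ * γ') - cell₁ (δ * δ') - (cell₁ γ - cell₁ δ + (cell₁ γ' - cell₁ δ'))
    rw [map_sub, d_cell₂, d_cell₂]
    abel

theorem relHMap_relDiff {Γ' G' : Type u} [Group Γ'] [Group G'] {f : Γ →* G} {f' : Γ' →* G'}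
    {a : Γ →* Γ'} {b : G →* G'} (h : b.comp f = f'.comp a) (γ δ : Γ) (hγ : f γ = f δ)
    (h' : f' (a γ) = f' (a δ)) :
    (relHMap 2 h).hom (relDiff f γ δ hγ) = relDiff f' (a γ) (a δ) h' := by
  refine homologyMap_cycleClass 1 (relChainsMap h) _ _ (Prod.ext ?_ ?_)
  · exact map_zero ((chainsMap b).f 2).hom
  · change ((chainsMap a).f 1).hom (cell₁ γ - cell₁ δ) = cell₁ (a γ) - cell₁ (a δ)
    rw [map_sub, chainsMap_cell₁, chainsMap_cell₁]

/-! ### The class of a central `f`-extension on generators. -/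

namespace CentralFExtension

variable {f : Γ →* G} {A : Type u} [AddCommGroup A] (E : CentralFExtension f A)

/-- On `(0, [γ] - [δ])` only `w` contributes, with value `w γ - w δ`; since `f γ = f δ`, the values
of the section cancel. -/
theorem classHom_relDiff (γ δ : Γ) (h : f γ = f δ) :
    E.ext.inl (Multiplicative.ofAdd (E.classHom (relDiff f γ δ h))) = E.ψ γ * (E.ψ δ)⁻¹ := by
  let σ : E.ext.Section := ⟨Function.surjInv E.ext.rightHom_surjective,
    Function.rightInverse_surjInv E.ext.rightHom_surjective⟩
  have h1 : E.classHom (relDiff f γ δ h) = E.cochain σ γ - E.cochain σ δ := by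
    refine (E.classHomOf_π σ _).trans ?_
    refine (congrArg (E.relCochain σ).hom (iCycles_toCyclesObj (relChains f) 1 _)).trans ?_
    change Finsupp.linearCombination (ULift.{u} ℤ)
        (fun g : Fin 2 → G => E.cocycle σ (g 0) (g 1)) 0 +
      Finsupp.linearCombination (ULift.{u} ℤ) (fun γ : Fin 1 → Γ => E.cochain σ (γ 0))
        (cell₁ γ - cell₁ δ) = _
    rw [map_zero, zero_add, map_sub, cell₁, cell₁]
    erw [Finsupp.linearCombination_single, Finsupp.linearCombination_single]
    rw [one_smul, one_smul]
  rw [h1, ofAdd_sub, map_div, cochain_spec, cochain_spec, h,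
    div_eq_mul_inv]
  group

end CentralFExtension

/-! ### The isomorphism `H₂(G, Γ) ≃ K/[K, Γ]`. -/

theorem map_ker_eq {f : Γ →* G} (k : f.ker) : f k = f 1 :=
  (MonoidHom.mem_ker.1 k.2).trans (map_one f).symm

theorem relDiff_congr (f : Γ →* G) {γ δ γ' δ' : Γ} (h₁ : γ = γ') (h₂ : δ = δ')
    (h : f γ = f δ) (h' : f γ' = f δ') : relDiff f γ δ h = relDiff f γ' δ' h' := by
  subst h₁ h₂; rfl

/-- The homomorphism `K → H₂(G, Γ)` that sends `k` to the class of `(0, [k] - [1])`. -/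
def kerToRelH (f : Γ →* G) : f.ker →* Multiplicative (relH 2 f) :=
  MonoidHom.mk' (fun k => Multiplicative.ofAdd (relDiff f k 1 (map_ker_eq k))) fun k l => by
    rw [← ofAdd_add, ← relDiff_mul f k 1 l 1 (map_ker_eq k) (map_ker_eq l)
      (by rw [mul_one]; exact map_ker_eq (k * l))]
    congr 1
    simp only [Subgroup.coe_mul, mul_one]

/-- The pair `(γ, δ)` is the product of `(γ δ⁻¹, 1)` and `(δ, δ)`, and the latter has class zero. -/
theorem relDiff_eq_kerToRelH (f : Γ →* G) (γ δ : Γ) (h : f γ = f δ) :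
    relDiff f γ δ h = (kerToRelH f ⟨γ * δ⁻¹, by simp [MonoidHom.mem_ker, h]⟩).toAdd := by
  have h1 : f (γ * δ⁻¹) = f 1 := by simp [h]
  have := relDiff_mul f (γ * δ⁻¹) 1 δ δ h1 rfl (by simp [h])
  rw [relDiff_self, add_zero] at this
  refine Eq.trans ?_ this
  congr 1 <;> simp

/-- Pair `k γ k⁻¹ γ⁻¹` with `1 γ 1 γ⁻¹ = 1`. By additivity the class is the sum of those of `(k,
1)`, `(γ, γ)`, `(k⁻¹, 1)` and `(γ⁻¹, γ⁻¹)`; the first and third cancel and the others vanish.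
General pairs `(γ, δ)` are needed here because `γ` need not lie in `K`. -/
theorem kerToRelH_commutator (f : Γ →* G) :
    (⁅f.ker, (⊤ : Subgroup Γ)⁆).subgroupOf f.ker ≤ (kerToRelH f).ker := by
  have h1 : ⁅f.ker, (⊤ : Subgroup Γ)⁆ ≤ (kerToRelH f).ker.map f.ker.subtype := by
    rw [Subgroup.commutator_le]
    rintro k hk γ -
    have h0 : f k = f 1 := map_ker_eq ⟨k, hk⟩
    have h0' : f k⁻¹ = f 1 := map_ker_eq ⟨k⁻¹, inv_mem hk⟩
    have h1 : f (k * γ) = f (1 * γ) := by rw [map_mul, h0, map_mul]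
    have h2 : f (k⁻¹ * γ⁻¹) = f (1 * γ⁻¹) := by rw [map_mul, h0', map_mul]
    have h3 : f (k * γ * (k⁻¹ * γ⁻¹)) = f (1 * γ * (1 * γ⁻¹)) := by
      rw [map_mul, h1, h2, ← map_mul]
    refine ⟨⟨k * γ * (k⁻¹ * γ⁻¹), by simpa [MonoidHom.mem_ker] using h3⟩, ?_, ?_⟩
    · have e : relDiff f (k * γ * (k⁻¹ * γ⁻¹)) (1 * γ * (1 * γ⁻¹)) h3 = 0 := by
        rw [relDiff_mul f _ _ _ _ h1 h2, relDiff_mul f _ _ _ _ h0 rfl,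
          relDiff_mul f _ _ _ _ h0' rfl, relDiff_self, relDiff_self, add_zero, add_zero,
          ← relDiff_mul f _ _ _ _ h0 h0' (by simp)]
        exact (relDiff_congr f (by simp) (by simp) _ rfl).trans (relDiff_self f 1 rfl)
      exact congrArg Multiplicative.ofAdd ((relDiff_congr f rfl (by simp) _ _).trans e)
    · simp [commutatorElement_def, mul_assoc]
  intro x hx
  obtain ⟨y, hy, hyx⟩ := h1 (Subgroup.mem_subgroupOf.1 hx)
  exact (Subtype.ext hyx : y = x) ▸ hy

/-- The homomorphism `K/[K, Γ] → H₂(G, Γ)`. -/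
def kerModToRelH (f : Γ →* G) : KerMod f →* Multiplicative (relH 2 f) :=
  QuotientGroup.lift _ (kerToRelH f) (kerToRelH_commutator f)

theorem kerModToRelH_mk (f : Γ →* G) (k : f.ker) :
    (kerModToRelH f (QuotientGroup.mk k)).toAdd = relDiff f k 1 (map_ker_eq k) := rfl

theorem relDiff_eq_kerModToRelH (f : Γ →* G) (γ δ : Γ) (h : f γ = f δ) :
    relDiff f γ δ h = (kerModToRelH f (QuotientGroup.mk
      ⟨γ * δ⁻¹, by simp [MonoidHom.mem_ker, h]⟩)).toAdd :=
  relDiff_eq_kerToRelH f γ δ h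

theorem quotientExtension_classHom_relDiff (f : Γ →* G) (hf : Function.Surjective f) (γ δ : Γ)
    (h : f γ = f δ) : (quotientExtension f hf).classHom (relDiff f γ δ h) =
      Additive.ofMul (QuotientGroup.mk ⟨γ * δ⁻¹, by simp [MonoidHom.mem_ker, h]⟩) := by
  apply Multiplicative.ofAdd.injective
  apply (quotientExtension f hf).ext.inl_injective
  rw [CentralFExtension.classHom_relDiff]
  rfl

theorem quotientExtension_classHom_kerModToRelH (f : Γ →* G) (hf : Function.Surjective f)
    (k : KerMod f) :
    (quotientExtension f hf).classHom (kerModToRelH f k).toAdd = Additive.ofMul k := by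
  obtain ⟨k, rfl⟩ := QuotientGroup.mk_surjective k
  rw [kerModToRelH_mk, quotientExtension_classHom_relDiff]
  congr 2
  simp

theorem kerModToRelH_quotientExtension_classHom (f : Γ →* G) (hf : Function.Surjective f)
    (x : relH 2 f) :
    (kerModToRelH f ((quotientExtension f hf).classHom x).toMul).toAdd = x := by
  have : (MonoidHom.toAdditiveLeft (kerModToRelH f)).comp (quotientExtension f hf).classHom =
      AddMonoidHom.id (relH 2 f) := by
    refine relH_two_hom_ext hf fun γ δ h => ?_
    change (kerModToRelH f ((quotientExtension f hf).classHom (relDiff f γ δ h)).toMul).toAdd =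
      relDiff f γ δ h
    rw [quotientExtension_classHom_relDiff, relDiff_eq_kerModToRelH]
    rfl
  exact DFunLike.congr_fun this x

/-- The isomorphism `H₂(G, Γ) ≃ K/[K, Γ]`. -/
def relHEquiv (f : Γ →* G) (hf : Function.Surjective f) : relH 2 f ≃+ Additive (KerMod f) where
  __ := (quotientExtension f hf).classHom
  invFun k := (kerModToRelH f k.toMul).toAdd
  left_inv := kerModToRelH_quotientExtension_classHom f hf
  right_inv k := quotientExtension_classHom_kerModToRelH f hf k.toMul

theorem relHEquiv_relDiff (f : Γ →* G) (hf : Function.Surjective f) (γ δ : Γ) (h : f γ = f δ) :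
    relHEquiv f hf (relDiff f γ δ h) =
      Additive.ofMul (QuotientGroup.mk ⟨γ * δ⁻¹, by simp [MonoidHom.mem_ker, h]⟩) :=
  quotientExtension_classHom_relDiff f hf γ δ h

/-- A single generator suffices, with no sums, because the inverse of `θ_f` is induced by a map
defined on `K`. -/
theorem exists_relDiff_eq (f : Γ →* G) (hf : Function.Surjective f) (x : relH 2 f) :
    ∃ k : f.ker, relDiff f k 1 (map_ker_eq k) = x := by
  obtain ⟨k, hk⟩ := QuotientGroup.mk_surjective ((quotientExtension f hf).classHom x).toMul
  refine ⟨k, ?_⟩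
  rw [← kerModToRelH_mk, hk, kerModToRelH_quotientExtension_classHom]

theorem relHEquiv_natural {Γ' G' : Type u} [Group Γ'] [Group G'] (f : Γ →* G)
    (hf : Function.Surjective f) (f' : Γ' →* G') (hf' : Function.Surjective f')
    (a : Γ →* Γ') (b : G →* G') (h : b.comp f = f'.comp a) (x : relH 2 f) :
    relHEquiv f' hf' (relHMap 2 h x) = (kerModMap h).toAdditive (relHEquiv f hf x) := by
  obtain ⟨k, rfl⟩ := exists_relDiff_eq f hf x
  have hk : f' (a k) = f' (a 1) := by
    have h1 := DFunLike.congr_fun h (k : Γ)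
    have h2 := DFunLike.congr_fun h 1
    exact h1.symm.trans ((congrArg b (map_ker_eq k)).trans h2)
  refine (congrArg (relHEquiv f' hf') (relHMap_relDiff h _ _ _ hk)).trans ?_
  rw [relHEquiv_relDiff, relHEquiv_relDiff]
  refine congrArg (fun t => Additive.ofMul (QuotientGroup.mk t)) (Subtype.ext ?_)
  change a k * (a 1)⁻¹ = a (k * 1⁻¹)
  rw [map_mul, map_inv]

/-! ### Maps of central `f`-extensions and universality. -/

namespace CentralFExtension

variable {f : Γ →* G} {A B : Type u} [AddCommGroup A] [AddCommGroup B]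

theorem classHom_identifyKernel (hf : Function.Surjective f) (E : CentralFExtension f A)
    (e : B ≃+ A) : (E.identifyKernel e).classHom = e.symm.toAddMonoidHom.comp E.classHom := by
  refine relH_two_hom_ext hf fun γ δ h => ?_
  apply Multiplicative.ofAdd.injective
  apply (E.identifyKernel e).ext.inl_injective
  rw [classHom_relDiff]
  change _ = E.ext.inl (Multiplicative.ofAdd (e (e.symm (E.classHom (relDiff f γ δ h)))))
  rw [e.apply_symm_apply, classHom_relDiff]
  rfl

theorem Hom.κ_comp_classHom (hf : Function.Surjective f) {E : CentralFExtension f A}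
    {E' : CentralFExtension f B} (h : E.Hom E') : h.κ.comp E.classHom = E'.classHom := by
  refine relH_two_hom_ext hf fun γ δ hγ => ?_
  apply Multiplicative.ofAdd.injective
  apply E'.ext.inl_injective
  rw [classHom_relDiff, AddMonoidHom.comp_apply, ← h.τ_inl, classHom_relDiff, map_mul, map_inv,
    h.τ_ψ, h.τ_ψ]

/-- The structure maps determine `τ` on the image of `ψ`, and `τ` determines `κ` because `inl` is
injective. -/
theorem Hom.ext_of_surjective {E : CentralFExtension f A} {E' : CentralFExtension f B}
    (hψ : Function.Surjective E.ψ) (h h' : E.Hom E') : h = h' := by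
  have hτ : h.τ = h'.τ := by
    ext m
    obtain ⟨γ, rfl⟩ := hψ m
    rw [h.τ_ψ, h'.τ_ψ]
  have hκ : h.κ = h'.κ := by
    ext a
    apply Multiplicative.ofAdd.injective
    apply E'.ext.inl_injective
    rw [← h.τ_inl, ← h'.τ_inl, hτ]
  cases h; cases h'
  congr

theorem ψ_mem_center (E : CentralFExtension f A) (k : f.ker) :
    E.ψ k ∈ Subgroup.center E.M := by
  have : E.ψ k ∈ E.ext.inl.range := by
    rw [E.ext.range_inl_eq_ker_rightHom, MonoidHom.mem_ker, rightHom_ψ]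
    exact k.2
  obtain ⟨a, ha⟩ := this
  exact ha ▸ E.central a

theorem commutator_le_ker_ψ (E : CentralFExtension f A) :
    ⁅f.ker, (⊤ : Subgroup Γ)⁆ ≤ E.ψ.ker := by
  rw [Subgroup.commutator_le]
  rintro k hk γ -
  rw [MonoidHom.mem_ker, map_commutatorElement, commutatorElement_eq_one_iff_mul_comm]
  exact (Subgroup.mem_center_iff.1 (E.ψ_mem_center ⟨k, hk⟩) (E.ψ γ)).symm

/-- The map from the central `f`-extension `Γ/[K, Γ]` to `E`. -/
def homOfQuotientExtension (hf : Function.Surjective f) (E : CentralFExtension f A) :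
    ((quotientExtension f hf).identifyKernel (relHEquiv f hf)).Hom E where
  -- This choice is forced by `Hom.κ_comp_classHom`, since the source corresponds to the identity.
  κ := E.classHom
  τ := QuotientGroup.lift _ E.ψ E.commutator_le_ker_ψ
  τ_inl x := by
    obtain ⟨k, rfl⟩ := exists_relDiff_eq f hf x
    rw [classHom_relDiff]
    change QuotientGroup.lift _ E.ψ E.commutator_le_ker_ψ
      (kerModIncl f (relHEquiv f hf (relDiff f k 1 _)).toMul) = _
    rw [relHEquiv_relDiff]
    change E.ψ (k * 1⁻¹) = _
    rw [map_mul, map_inv]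
  rightHom_τ m := by
    obtain ⟨γ, rfl⟩ := QuotientGroup.mk_surjective m
    exact E.rightHom_ψ γ
  τ_ψ γ := rfl

theorem identifyKernel_ψ_surjective (hf : Function.Surjective f) :
    Function.Surjective ((quotientExtension f hf).identifyKernel (relHEquiv f hf)).ψ :=
  QuotientGroup.mk'_surjective _

theorem isUniversal_quotientExtension (hf : Function.Surjective f) :
    ((quotientExtension f hf).identifyKernel (relHEquiv f hf)).IsUniversal := by
  rw [IsUniversal, classHom_identifyKernel hf]
  ext x
  exact (relHEquiv f hf).symm_apply_apply x

/-- The canonical map to `E` has `κ = E.classHom`, so it is an equivalence exactly when `E`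
corresponds to the identity. -/
theorem isUniversal_iff_equivalent (hf : Function.Surjective f)
    (E : CentralFExtension f (relH 2 f)) : E.IsUniversal ↔
      ((quotientExtension f hf).identifyKernel (relHEquiv f hf)).Equivalent E := by
  constructor
  · exact fun h => ⟨E.homOfQuotientExtension hf, h⟩
  · rintro ⟨h, hκ⟩
    rw [IsUniversal, ← h.κ_comp_classHom hf, hκ, isUniversal_quotientExtension hf]
    rfl

end CentralFExtension

end

/-! ### Vanishing of `H₂` of a free group. -/

noncomputable section

/-- The central extension of `G` by `A` defined by the `2`-cocycle `c`. -/
@[ext]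
structure CocycleExtension {G A : Type*} [Group G] [AddCommGroup A] (c : G → G → A)
    (hc : ∀ g h k, c g h + c (g * h) k = c h k + c g (h * k)) where
  fst : A
  snd : G

namespace CocycleExtension

variable {G A : Type*} [Group G] [AddCommGroup A] {c : G → G → A}
  {hc : ∀ g h k, c g h + c (g * h) k = c h k + c g (h * k)}

instance : Mul (CocycleExtension c hc) := ⟨fun x y => ⟨x.1 + y.1 + c x.2 y.2, x.2 * y.2⟩⟩

/-- The cocycle is not assumed normalized. The correction `-c 1 1` works because `c 1 g = c 1 1` for
all `g`. -/
instance : One (CocycleExtension c hc) := ⟨⟨-c 1 1, 1⟩⟩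

instance : Inv (CocycleExtension c hc) := ⟨fun x => ⟨-x.1 - c x.2⁻¹ x.2 - c 1 1, x.2⁻¹⟩⟩

theorem fst_mul (x y : CocycleExtension c hc) : (x * y).fst = x.fst + y.fst + c x.snd y.snd := rfl

theorem snd_mul (x y : CocycleExtension c hc) : (x * y).snd = x.snd * y.snd := rfl

theorem fst_one : (1 : CocycleExtension c hc).fst = -c 1 1 := rfl

theorem snd_one : (1 : CocycleExtension c hc).snd = 1 := rfl

theorem cocycle_one_left (hc : ∀ g h k, c g h + c (g * h) k = c h k + c g (h * k)) (g : G) :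
    c 1 g = c 1 1 := by
  have := hc 1 1 g
  simp only [one_mul] at this
  exact (add_right_cancel this).symm

instance : Group (CocycleExtension c hc) :=
  Group.ofLeftAxioms
    (fun x y z => by
      refine CocycleExtension.ext ?_ (mul_assoc _ _ _)
      simp only [fst_mul, snd_mul]
      have := hc x.snd y.snd z.snd
      calc x.fst + y.fst + c x.snd y.snd + z.fst + c (x.snd * y.snd) z.snd
          = x.fst + y.fst + z.fst + (c x.snd y.snd + c (x.snd * y.snd) z.snd) := by abel
        _ = _ := by rw [this]; abel)
    (fun x => by
      refine CocycleExtension.ext ?_ (one_mul _)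
      simp only [fst_mul, fst_one, snd_one]
      rw [cocycle_one_left hc x.snd]
      abel)
    (fun x => by
      refine CocycleExtension.ext ?_ (inv_mul_cancel _)
      change -x.fst - c x.snd⁻¹ x.snd - c 1 1 + x.fst + c x.snd⁻¹ x.snd = -c 1 1
      abel)

/-- The projection of a cocycle extension. -/
def sndHom : CocycleExtension c hc →* G where
  toFun := snd
  map_one' := rfl
  map_mul' _ _ := rfl

end CocycleExtension

/-- Every `2`-cocycle of a free group with trivial coefficients is a coboundary. -/
theorem exists_coboundary_of_isFreeGroup {F A : Type*} [Group F] [IsFreeGroup F] [AddCommGroup A]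
    (c : F → F → A) (hc : ∀ g h k, c g h + c (g * h) k = c h k + c g (h * k)) :
    ∃ b : F → A, ∀ g h, b (g * h) = b g + b h + c g h := by
  -- Freeness splits the extension; the first coordinate of the splitting is the required cochain.
  let s : F →* CocycleExtension c hc := IsFreeGroup.lift fun x => ⟨0, IsFreeGroup.of x⟩
  have hs : CocycleExtension.sndHom.comp s = MonoidHom.id F := by
    refine IsFreeGroup.ext_hom fun x => ?_
    change (s (IsFreeGroup.of x)).snd = IsFreeGroup.of x
    rw [IsFreeGroup.lift_of]
  have hs' (g : F) : (s g).snd = g := DFunLike.congr_fun hs g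
  refine ⟨fun g => (s g).fst, fun g h => ?_⟩
  simp only [map_mul, CocycleExtension.fst_mul, hs']

variable {Γ G : Type u} [Group Γ] [Group G]

/-- Apply the vanishing of cocycle classes to the tautological cocycle `(g, h) ↦ [g | h]` with
values in `C_2(F)` modulo boundaries. Writing it as a coboundary makes the class of `x` in this
quotient a function of `d x`. -/
theorem exists_d_eq_of_isFreeGroup {F : Type u} [Group F] [IsFreeGroup F] (x : (chains F).X 2)
    (hx : ((chains F).d 2 1).hom x = 0) : ∃ w, ((chains F).d 3 2).hom w = x := by
  let B := LinearMap.range ((chains F).d 3 2).hom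
  obtain ⟨b, hb⟩ := exists_coboundary_of_isFreeGroup
    (fun g h : F => B.mkQ (cell₂ g h)) fun g h k => by
      have h1 : B.mkQ (((chains F).d 3 2).hom (Finsupp.single ![g, h, k] (1 : ULift.{u} ℤ))) = 0 :=
        (Submodule.Quotient.mk_eq_zero _).2 ⟨_, rfl⟩
      rw [d_three_single, map_sub, map_add, map_sub] at h1
      rw [← sub_eq_zero, ← neg_eq_zero]
      refine Eq.trans ?_ h1
      change _ = B.mkQ (cell₂ h k) - B.mkQ (cell₂ (g * h) k) + B.mkQ (cell₂ g (h * k)) -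
        B.mkQ (cell₂ g h)
      abel
  let β : (chains F).X 1 →ₗ[ULift.{u} ℤ] (chains F).X 2 ⧸ B :=
    Finsupp.linearCombination (ULift.{u} ℤ) fun g : Fin 1 → F => b (g 0)
  have hβ (g : F) : β (cell₁ g) = b g :=
    (Finsupp.linearCombination_single _ _ _).trans (one_smul _ _)
  have key : ∀ x : (chains F).X 2, B.mkQ x = -β (((chains F).d 2 1).hom x) := by
    intro x
    refine chains_X_induction
      (p := fun x : (chains F).X 2 => B.mkQ x = -β (((chains F).d 2 1).hom x)) x ?_ ?_
      fun g r => ?_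
    · rw [map_zero, map_zero, map_zero, neg_zero]
    · intro x y hx hy
      rw [map_add, map_add, map_add, hx, hy, neg_add]
    · rw [cell₂_eq, map_zsmul, map_zsmul, map_zsmul, d_cell₂, ← smul_neg]
      congr 1
      rw [map_add, map_sub, hβ, hβ, hβ, hb]
      abel
  have := key x
  rw [hx, map_zero, neg_zero] at this
  exact (Submodule.Quotient.mk_eq_zero _).1 this

theorem H_two_eq_zero_of_isFreeGroup {F : Type u} [Group F] [IsFreeGroup F] (z : H 2 F) :
    z = 0 := by
  obtain ⟨⟨x, hx⟩, rfl⟩ := cycleClass_surjective (chains F) 1 z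
  exact (cycleClass_eq_zero_iff _ _ _).2 (exists_d_eq_of_isFreeGroup x hx)

/-! ### Exactness of the five term sequence. -/

theorem relChains_d_inl (f : Γ →* G) (x : LinearMap.ker ((chains G).d 2 1).hom) :
    ((relChains f).d 2 1).hom (((x : (chains G).X 2), (0 : (chains Γ).X 1)) :
      (chains G).X 2 × (chains Γ).X 1) = 0 := by
  refine (relChains_d_apply f _ _).trans (Prod.ext ?_ rfl)
  change ((chains G).d 2 1).hom x - ((chainsMap f).f 1).hom 0 = 0
  rw [map_zero, sub_zero, x.2]

theorem toRelH_cycleClass (f : Γ →* G) (x : LinearMap.ker ((chains G).d 2 1).hom) :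
    toRelH 2 f (cycleClass (chains G) 1 x) =
      cycleClass (relChains f) 1 ⟨_, relChains_d_inl f x⟩ :=
  homologyMap_cycleClass 1 (relIncl f) x _ rfl

theorem chainsMap_d_two (f : Γ →* G) (y : (chains Γ).X 2) :
    ((chains G).d 2 1).hom (((chainsMap f).f 2).hom y) =
      ((chainsMap f).f 1).hom (((chains Γ).d 2 1).hom y) :=
  congrArg (fun t => t.hom y) ((chainsMap f).comm 2 1)

theorem exact_HMap_toRelH (f : Γ →* G) : Function.Exact (HMap 2 f) (toRelH 2 f) := by
  intro c
  obtain ⟨x, rfl⟩ := cycleClass_surjective (chains G) 1 c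
  refine (Eq.congr_left (toRelH_cycleClass f x)).trans ((cycleClass_eq_zero_iff _ _ _).trans ?_)
  constructor
  · rintro ⟨w, hw⟩
    obtain ⟨v, y⟩ : (chains G).X 3 × (chains Γ).X 2 := w
    have hw := (relChains_d_three_apply f v y).symm.trans hw
    have h1 : ((chains G).d 3 2).hom v - ((chainsMap f).f 2).hom y = x := congrArg Prod.fst hw
    have h2 : -((chains Γ).d 2 1).hom y = 0 := congrArg Prod.snd hw
    have hv : ((chains G).d 2 1).hom (((chains G).d 3 2).hom v) = 0 :=
      congrArg (fun t => t.hom v) ((chains G).d_comp_d 3 2 1)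
    -- From `x = d v - f y`, the cycle `f (-y)` is homologous to `x`.
    refine ⟨cycleClass (chains Γ) 1 ⟨-y, by rw [LinearMap.mem_ker, map_neg, h2]⟩, ?_⟩
    refine (homologyMap_cycleClass 1 (chainsMap f) _ (x - ⟨((chains G).d 3 2).hom v, hv⟩) ?_).trans
      ?_
    · change ((chainsMap f).f 2).hom (-y) = x - ((chains G).d 3 2).hom v
      rw [map_neg, ← h1]
      abel
    · rw [map_sub, (cycleClass_eq_zero_iff _ _ ⟨((chains G).d 3 2).hom v, hv⟩).2 ⟨v, rfl⟩, sub_zero]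
  · rintro ⟨e, he⟩
    obtain ⟨y, rfl⟩ := cycleClass_surjective (chains Γ) 1 e
    have hfy : ((chainsMap f).f 2).hom y ∈ LinearMap.ker ((chains G).d 2 1).hom := by
      rw [LinearMap.mem_ker, chainsMap_d_two, y.2, map_zero]
    have h1 := (homologyMap_cycleClass 1 (chainsMap f) y ⟨_, hfy⟩ rfl).symm.trans he
    rw [← sub_eq_zero, ← map_sub, cycleClass_eq_zero_iff] at h1
    obtain ⟨w, hw⟩ := h1
    refine ⟨((-w, -y) : (chains G).X 3 × (chains Γ).X 2),
      (relChains_d_three_apply f _ _).trans (Prod.ext ?_ ?_)⟩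
    · change ((chains G).d 3 2).hom (-w) - ((chainsMap f).f 2).hom (-(y : (chains Γ).X 2)) = x
      rw [map_neg, map_neg, hw]
      change -(((chainsMap f).f 2).hom (y : (chains Γ).X 2) - x) - -_ = _
      abel
    · change -((chains Γ).d 2 1).hom (-(y : (chains Γ).X 2)) = 0
      rw [map_neg, y.2, neg_zero, neg_zero]

/-- `(C_2(f) y, 0)` and `(0, -d y)` are homologous. -/
theorem toRelH_chainsMap (f : Γ →* G) (y : (chains Γ).X 2)
    (x : LinearMap.ker ((chains G).d 2 1).hom) (hx : ((chainsMap f).f 2).hom y = x)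
    (v : LinearMap.ker ((chainsMap f).f 1).hom) (hv : ((chains Γ).d 2 1).hom y = -v) :
    toRelH 2 f (cycleClass (chains G) 1 x) = relOfKer f v := by
  refine (toRelH_cycleClass f x).trans ?_
  rw [← sub_eq_zero]
  refine (map_sub (cycleClass (relChains f) 1) _ _).symm.trans ?_
  rw [cycleClass_eq_zero_iff]
  refine ⟨((0, -y) : (chains G).X 3 × (chains Γ).X 2),
    (relChains_d_three_apply f _ _).trans (Prod.ext ?_ ?_)⟩
  · change ((chains G).d 3 2).hom 0 - ((chainsMap f).f 2).hom (-y) = (x : (chains G).X 2) - 0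
    rw [map_zero, map_neg, hx]
    abel
  · change -((chains Γ).d 2 1).hom (-y) = 0 - (v : (chains Γ).X 1)
    rw [map_neg, hv]
    abel

/-- Modulo boundaries, `γ ↦ [γ]` is a homomorphism to an abelian group, so it kills commutators. -/
theorem cell₁_mem_range_of_mem_commutator (γ : Γ) (hγ : γ ∈ commutator Γ) :
    cell₁ γ ∈ LinearMap.range ((chains Γ).d 2 1).hom := by
  let B := LinearMap.range ((chains Γ).d 2 1).hom
  let φ : Γ →* Multiplicative ((chains Γ).X 1 ⧸ B) :=
    MonoidHom.mk' (fun γ => Multiplicative.ofAdd (B.mkQ (cell₁ γ))) fun γ δ => by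
      rw [← ofAdd_add, ← map_add]
      refine congrArg Multiplicative.ofAdd ((Submodule.Quotient.eq _).2 ⟨-cell₂ γ δ, ?_⟩)
      rw [map_neg, d_cell₂]
      abel
  exact (Submodule.Quotient.mk_eq_zero _).1
    (congrArg Multiplicative.toAdd (Abelianization.commutator_subset_ker φ hγ))

/-- The map `C_1(Γ) → Γ_ab`, `[γ] ↦ γ`. -/
def chainsToAb (Γ : Type u) [Group Γ] : (chains Γ).X 1 →ₗ[ULift.{u} ℤ]
    Additive (Abelianization Γ) :=
  Finsupp.linearCombination (ULift.{u} ℤ) fun g : Fin 1 → Γ =>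
    Additive.ofMul (Abelianization.of (g 0))

theorem chainsToAb_cell₁ (γ : Γ) :
    chainsToAb Γ (cell₁ γ) = Additive.ofMul (Abelianization.of γ) :=
  (Finsupp.linearCombination_single _ _ _).trans (one_smul _ _)

theorem chainsToAb_d (y : (chains Γ).X 2) : chainsToAb Γ (((chains Γ).d 2 1).hom y) = 0 := by
  refine chains_X_induction (p := fun y => chainsToAb Γ (((chains Γ).d 2 1).hom y) = 0) y
    (by rw [map_zero, map_zero]) (fun x y hx hy => by rw [map_add, map_add, hx, hy, add_zero])
    fun g r => ?_
  rw [cell₂_eq, map_zsmul, map_zsmul, d_cell₂, map_add, map_sub, chainsToAb_cell₁,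
    chainsToAb_cell₁, chainsToAb_cell₁, map_mul, ofMul_mul]
  convert smul_zero r
  abel

/-- Identifies `K/[K, Γ] → Γ_ab` with the connecting map `(0, v) ↦ v`; on a generator both sides are
the class of `γ δ⁻¹`. -/
theorem kerModToAb_relOfKer (f : Γ →* G) (hf : Function.Surjective f)
    (v : LinearMap.ker ((chainsMap f).f 1).hom) :
    (kerModToAb f).toAdditive (relHEquiv f hf (relOfKer f v)) = chainsToAb Γ v := by
  have : ((kerModToAb f).toAdditive.comp (relHEquiv f hf).toAddMonoidHom).comp
      (relOfKer f).toAddMonoidHom = ((chainsToAb Γ) ∘ₗ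
        (LinearMap.ker ((chainsMap f).f 1).hom).subtype).toAddMonoidHom := by
    refine AddMonoidHom.eq_of_eqOn_dense (kerDiff_closure f hf) ?_
    rintro _ ⟨γ, δ, h, rfl⟩
    change (kerModToAb f).toAdditive (relHEquiv f hf (relDiff f γ δ h)) =
      chainsToAb Γ (cell₁ γ - cell₁ δ)
    rw [relHEquiv_relDiff, map_sub, chainsToAb_cell₁, chainsToAb_cell₁, ← ofMul_div,
      ← map_div, div_eq_mul_inv]
    rfl
  exact DFunLike.congr_fun this v

theorem kerModToAb_mk_eq_one_iff (f : Γ →* G) (k : f.ker) :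
    kerModToAb f (QuotientGroup.mk k) = 1 ↔ (k : Γ) ∈ commutator Γ :=
  QuotientGroup.eq_one_iff (k : Γ)

theorem exact_toRelH_kerModToAb (f : Γ →* G) (hf : Function.Surjective f) :
    Function.Exact (fun z => relHEquiv f hf (toRelH 2 f z)) (kerModToAb f).toAdditive := by
  intro q
  constructor
  · intro hq
    obtain ⟨k, hk⟩ := QuotientGroup.mk_surjective q.toMul
    obtain rfl : Additive.ofMul (QuotientGroup.mk k) = q := congrArg Additive.ofMul hk
    have hk : (k : Γ) ∈ commutator Γ := (kerModToAb_mk_eq_one_iff f k).1 hq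
    -- Both `[k]` and `[1]` are boundaries, so `[k] - [1] = d y`. As `k` lies in `K`, the chain `f
    -- (-y)` is a cycle, and it maps to the class of `(0, [k] - [1])`.
    obtain ⟨y, hy⟩ := sub_mem (cell₁_mem_range_of_mem_commutator _ hk)
      (cell₁_mem_range_of_mem_commutator _ (one_mem (commutator Γ)))
    have hfy : ((chains G).d 2 1).hom (((chainsMap f).f 2).hom (-y)) = 0 := by
      rw [chainsMap_d_two, map_neg, hy, map_neg, map_sub, chainsMap_cell₁, chainsMap_cell₁,
        map_ker_eq, sub_self, neg_zero]
    refine ⟨cycleClass (chains G) 1 ⟨_, hfy⟩, ?_⟩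
    refine (congrArg (relHEquiv f hf) (toRelH_chainsMap f (-y) ⟨_, hfy⟩ rfl
      (kerDiff f k 1 (map_ker_eq k)) ?_)).trans ?_
    · rw [map_neg, hy]; rfl
    · refine (relHEquiv_relDiff f hf k 1 (map_ker_eq k)).trans ?_
      congr 2
      simp
  · rintro ⟨z, rfl⟩
    obtain ⟨x, rfl⟩ := cycleClass_surjective (chains G) 1 z
    obtain ⟨y, hy⟩ := chainsMap_two_surjective f hf x
    have hv : ((chainsMap f).f 1).hom (-((chains Γ).d 2 1).hom y) = 0 := by
      rw [map_neg, ← chainsMap_d_two, hy, x.2, neg_zero]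
    refine (congrArg (fun t => (kerModToAb f).toAdditive (relHEquiv f hf t))
      (toRelH_chainsMap f y x hy ⟨_, hv⟩ (neg_neg _).symm)).trans ?_
    refine (kerModToAb_relOfKer f hf _).trans ?_
    change chainsToAb Γ (-((chains Γ).d 2 1).hom y) = 0
    rw [map_neg, chainsToAb_d, neg_zero]

theorem exact_kerModToAb_map (f : Γ →* G) (hf : Function.Surjective f) :
    Function.Exact (kerModToAb f).toAdditive (Abelianization.map f).toAdditive := by
  intro q
  constructor
  · intro hq
    obtain ⟨γ, hγ⟩ := QuotientGroup.mk_surjective q.toMul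
    obtain rfl : Additive.ofMul (QuotientGroup.mk γ) = q := congrArg Additive.ofMul hγ
    have hγ : f γ ∈ commutator G := (QuotientGroup.eq_one_iff (f γ)).1 hq
    -- As `f` is onto, `[G, G]` is the image of `[Γ, Γ]`. Hence `f γ = f c` with `c` in `[Γ, Γ]`,
    -- and `γ c⁻¹` is an element of `K` with the same class as `γ` in `Γ_ab`.
    rw [commutator_def, ← Subgroup.map_top_of_surjective f hf, ← Subgroup.map_commutator] at hγ
    obtain ⟨c, hc, hcγ⟩ := hγ
    refine ⟨Additive.ofMul (QuotientGroup.mk ⟨γ * c⁻¹, by simp [MonoidHom.mem_ker, hcγ]⟩), ?_⟩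
    refine congrArg Additive.ofMul ((QuotientGroup.eq (s := commutator Γ)).2 ?_)
    change (γ * c⁻¹)⁻¹ * γ ∈ _
    rw [commutator_def]
    simpa using hc
  · rintro ⟨k, rfl⟩
    obtain ⟨k', hk⟩ := QuotientGroup.mk_surjective k.toMul
    obtain rfl : Additive.ofMul (QuotientGroup.mk k') = k := congrArg Additive.ofMul hk
    refine congrArg Additive.ofMul (?_ : Abelianization.of (f k') = 1)
    rw [MonoidHom.mem_ker.1 k'.2, map_one]

theorem abelianization_map_surjective (f : Γ →* G) (hf : Function.Surjective f) :
    Function.Surjective (Abelianization.map f) := by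
  intro q
  obtain ⟨g, rfl⟩ := QuotientGroup.mk_surjective q
  obtain ⟨γ, rfl⟩ := hf g
  exact ⟨Abelianization.of γ, rfl⟩

/-! ### Hopf's formula. -/

theorem hopfModIncl_injective (f : Γ →* G) : Function.Injective (hopfModIncl f) := by
  rw [injective_iff_map_eq_one]
  intro x hx
  obtain ⟨a, rfl⟩ := QuotientGroup.mk_surjective x
  exact (QuotientGroup.eq_one_iff a).2 (Subgroup.mem_subgroupOf.2
    (Subgroup.mem_subgroupOf.1 ((QuotientGroup.eq_one_iff (Subgroup.inclusion inf_le_left a)).1 hx)))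

theorem exact_hopfModIncl_kerModToAb (f : Γ →* G) :
    Function.Exact (hopfModIncl f).toAdditive (kerModToAb f).toAdditive := by
  intro q
  constructor
  · intro hq
    obtain ⟨k, hk⟩ := QuotientGroup.mk_surjective q.toMul
    obtain rfl : Additive.ofMul (QuotientGroup.mk k) = q := congrArg Additive.ofMul hk
    exact ⟨Additive.ofMul (QuotientGroup.mk
      ⟨k, Subgroup.mem_inf.2 ⟨k.2, (kerModToAb_mk_eq_one_iff f k).1 hq⟩⟩), rfl⟩
  · rintro ⟨k, rfl⟩
    obtain ⟨k', hk⟩ := QuotientGroup.mk_surjective k.toMul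
    obtain rfl : Additive.ofMul (QuotientGroup.mk k') = k := congrArg Additive.ofMul hk
    exact (kerModToAb_mk_eq_one_iff f (Subgroup.inclusion inf_le_left k')).2 k'.2.2

theorem exact_HMap_relHEquiv (f : Γ →* G) (hf : Function.Surjective f) :
    Function.Exact (HMap 2 f) (fun z => relHEquiv f hf (toRelH 2 f z)) := fun z =>
  (EmbeddingLike.map_eq_zero_iff (f := relHEquiv f hf)).trans (exact_HMap_toRelH f z)

/-- The homomorphism `H₂(G) → K/[K, Γ]`. -/
def toKerMod (f : Γ →* G) (hf : Function.Surjective f) : H 2 G →+ Additive (KerMod f) :=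
  (relHEquiv f hf).toAddMonoidHom.comp (toRelH 2 f).hom.toAddMonoidHom

theorem toKerMod_injective {F : Type u} [Group F] [IsFreeGroup F] (p : F →* G)
    (hp : Function.Surjective p) : Function.Injective (toKerMod p hp) := by
  rw [injective_iff_map_eq_zero]
  intro z hz
  obtain ⟨w, rfl⟩ := (exact_HMap_relHEquiv p hp z).1 hz
  rw [H_two_eq_zero_of_isFreeGroup w]
  exact map_zero (HMap 2 p).hom

/-- Both ranges are the kernel of `K/[K, Γ] → Γ_ab`. -/
theorem range_toKerMod (f : Γ →* G) (hf : Function.Surjective f) :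
    (toKerMod f hf).range = (hopfModIncl f).toAdditive.range := by
  ext q
  exact (exact_toRelH_kerModToAb f hf q).symm.trans (exact_hopfModIncl_kerModToAb f q)

/-- Hopf's formula: `H₂(G) ≃ (R ∩ [F, F])/[R, F]`. -/
def hopfEquiv {F : Type u} [Group F] [IsFreeGroup F] (p : F →* G)
    (hp : Function.Surjective p) : H 2 G ≃+ Additive (HopfMod p) :=
  ((AddMonoidHom.ofInjective (toKerMod_injective p hp)).trans
    (AddEquiv.addSubgroupCongr (range_toKerMod p hp))).trans
    (AddMonoidHom.ofInjective (f := (hopfModIncl p).toAdditive) (hopfModIncl_injective p)).symm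

theorem hopfModIncl_hopfEquiv {F : Type u} [Group F] [IsFreeGroup F] (p : F →* G)
    (hp : Function.Surjective p) (z : H 2 G) :
    (hopfModIncl p).toAdditive (hopfEquiv p hp z) = toKerMod p hp z :=
  congrArg Subtype.val ((AddMonoidHom.ofInjective (f := (hopfModIncl p).toAdditive)
    (hopfModIncl_injective p)).apply_symm_apply _)

end

end RelativeSchur

theorem mainTheorem6 :
    ∃ θ : ∀ {Γ G : Type u} [Group Γ] [Group G] (f : Γ →* G), Function.Surjective f →
        (relH 2 f ≃+ Additive (KerMod f)),
      -- `K/[K, Γ] → Γ/[K, Γ] → G`, with the natural quotient map as structure map, and with its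
      -- kernel identified with `H₂(G, Γ)` by `θ`, is the universal central `f`-extension
      (∀ {Γ G : Type u} [Group Γ] [Group G] (f : Γ →* G) (hf : Function.Surjective f),
        ((quotientExtension f hf).identifyKernel (θ f hf)).IsUniversal ∧
        (∀ E : CentralFExtension f (relH 2 f), E.IsUniversal ↔
          ((quotientExtension f hf).identifyKernel (θ f hf)).Equivalent E) ∧
        (∀ (A : Type u) [AddCommGroup A] (E : CentralFExtension f A),
          Nonempty (Unique (((quotientExtension f hf).identifyKernel (θ f hf)).Hom E)))) ∧
      -- `θ` is natural in `f`
      (∀ {Γ G Γ' G' : Type u} [Group Γ] [Group G] [Group Γ'] [Group G']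
        (f : Γ →* G) (hf : Function.Surjective f) (f' : Γ' →* G') (hf' : Function.Surjective f')
        (a : Γ →* Γ') (b : G →* G') (h : b.comp f = f'.comp a) (x : relH 2 f),
        θ f' hf' (relHMap 2 h x) = (kerModMap h).toAdditive (θ f hf x)) ∧
      -- the five term exact sequence `H₂(Γ) → H₂(G) → K/[K, Γ] → Γ_ab → G_ab → 0`
      (∀ {Γ G : Type u} [Group Γ] [Group G] (f : Γ →* G) (hf : Function.Surjective f),
        Function.Exact (HMap 2 f) (fun z => θ f hf (toRelH 2 f z)) ∧
        Function.Exact (fun z => θ f hf (toRelH 2 f z)) (kerModToAb f).toAdditive ∧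
        Function.Exact (kerModToAb f).toAdditive (Abelianization.map f).toAdditive ∧
        Function.Surjective (Abelianization.map f)) ∧
      -- Hopf's formula: for a free group `F`, the map `H₂(G) → R/[R, F]` is an isomorphism onto
      -- `(R ∩ [F, F])/[R, F]`
      (∀ {F G : Type u} [Group F] [Group G] [IsFreeGroup F]
        (p : F →* G) (hp : Function.Surjective p),
        Function.Injective (fun z => θ p hp (toRelH 2 p z)) ∧
        ∃ e : H 2 G ≃+ Additive (HopfMod p),
          ∀ z, (hopfModIncl p).toAdditive (e z) = θ p hp (toRelH 2 p z)) := by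
  refine ⟨relHEquiv, fun f hf => ⟨CentralFExtension.isUniversal_quotientExtension hf,
    CentralFExtension.isUniversal_iff_equivalent hf, fun A _ E => ⟨⟨⟨E.homOfQuotientExtension hf⟩,
      fun h => h.ext_of_surjective (CentralFExtension.identifyKernel_ψ_surjective hf) _⟩⟩⟩,
    relHEquiv_natural, fun f hf => ⟨exact_HMap_relHEquiv f hf, exact_toRelH_kerModToAb f hf,
      exact_kerModToAb_map f hf, abelianization_map_surjective f hf⟩,
    fun p hp => ⟨toKerMod_injective p hp, hopfEquiv p hp, hopfModIncl_hopfEquiv p hp⟩⟩
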